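/- All terms are untyped $\lambda$-terms up to $\alpha$-equivalence, and $M,N,P,Q,R,F,G,H,J$ (with indices) denote closed terms; $\twoheadrightarrow$ is $\beta\eta$-reduction in any number of steps. A closed term is a zero-term if it does not $\beta$-reduce to an abstraction. A set $\mathcal X$ of closed terms is supercofinal if every closed term has a $\beta\eta$-reduct in $\mathcal X$ and $\mathcal X$ contains every closed term that does not $\beta\eta$-reduce to a zero-term. Proofs of equations $A=_\omega B$ (equality of the $\lambda\beta$-calculus with the $\omega$-rule) are well-founded trees: a proof either ends in an instance of the $\omega$-rule, which infers $P=_\omega Q$ from proofs of $PR=_\omega QR$ for all closed $R$, or ends in an endpiece $$A\twoheadrightarrow H_1\twoheadleftarrow G_1M_1=_\omega G_1N_1\twoheadrightarrow H_2\twoheadleftarrow\cdots\twoheadleftarrow G_tM_t=_\omega G_tN_t\twoheadrightarrow H_{t+1}\twoheadleftarrow B\qquad(t\ge 0),$$ where each $M_i=_\omega N_i$ is proved by a tree $\mathcal T_i$ that ends in an instance of the $\omega$-rule. With $\oplus$ the Hessenberg sum, the ordinal of a proof is $\omega^\theta$, $\theta=\sup_i(\mathrm{ord}(\mathcal S_1)\oplus\dots\oplus\mathrm{ord}(\mathcal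 S_i))$, if the proof ends in an $\omega$-rule whose premises have proofs $\mathcal S_1,\mathcal S_2,\dots$, and $1\oplus\mathrm{ord}(\mathcal T_1)\oplus\dots\oplus\mathrm{ord}(\mathcal T_t)$ if it ends in an endpiece as above; in the latter case its rank is $\max_i\mathrm{ord}(\mathcal T_i)$ (and $0$ if $t=0$). A proof is $\mathcal X$-canonical if (inductively) it ends in an $\omega$-rule and the proofs of all premises are $\mathcal X$-canonical, or it ends in an endpiece as above such that all $\mathcal T_i$ are $\mathcal X$-canonical, all $H_1,\dots,H_{t+1}$ are in $\mathcal X$, and for each $i=1,\dots,t$ there are $m,n\ge 0$ and terms $Y,L_1,\dots,L_m,Z_1,\dots,Z_n$ with $$G_i\equiv\lambda x.\lambda y_1\dots y_n.((\lambda y.Y)L_1\cdots L_m)Z_1\cdots Z_n$$ such that (a) $G_iM_i\twoheadrightarrow H_i$ by one $\beta$-step to $[M_i/x](\lambda y_1\dots y_n.((\lambda y.Y)L_1\cdots L_m)Z_1\cdots Z_n)$, followed by a sequence of non-head $\beta$-steps, followed by a sequence of $\eta$-steps; and (b) with $C=[N_i/x]((\lambda y.Y)L_1\cdots L_m)$,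 $G_iN_i\twoheadrightarrow H_{i+1}$ by a reduction of the form $$G_iN_i\to_\beta[N_i/x](\lambda y_1\dots y_n.((\lambda y.Y)L_1\cdots L_m)Z_1\cdots Z_n)\twoheadrightarrow\lambda y_1\dots y_n.\,C\,y_1\cdots y_n\twoheadrightarrow_\eta C\twoheadrightarrow J_0J_1\cdots J_m\twoheadrightarrow H_{i+1},$$ where $J_0$ is the $\beta\eta$-normal form of $[N_i/x]\lambda y.Y$ if it exists and $[N_i/x]\lambda y.Y$ otherwise, and, for $k=1,\dots,m$, $J_k$ is the $\beta\eta$-normal form of $[N_i/x]L_k$ if it exists and $[N_i/x]L_k$ otherwise. Proposition. Let $\mathcal X$ be a supercofinal set and let $\mathcal T$ be an $\mathcal X$-canonical proof of $M=_\omega N$ that ends in an endpiece. Then for every finite sequence $P_1,\dots,P_m$ of closed terms there are closed terms $R_1,\dots,R_n$ ($n\ge 0$) such that $MP_1\cdots P_mR_1\cdots R_n=_\omega NP_1\cdots P_mR_1\cdots R_n$ has an $\mathcal X$-canonical proof $\mathcal T_1$, also ending in an endpiece, with $\mathrm{rank}(\mathcal T_1)=\mathrm{rank}(\mathcal T)$.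 -/

import Mathlib

namespace LamOmega

/-- Untyped lambda terms up to alpha-equivalence, in well-scoped de Bruijn notation:
`Tm k` is the type of terms whose free variables are among `k` given ones, index `0` being the
innermost. In particular `Tm 0` is the type of closed terms. -/
inductive Tm : ℕ → Type
  | var {k : ℕ} (i : Fin k) : Tm k
  | app {k : ℕ} (t u : Tm k) : Tm k
  | lam {k : ℕ} (t : Tm (k + 1)) : Tm k

namespace Tm

/-- Renaming of free variables. -/
def rename {k : ℕ} : Tm k → {l : ℕ} → (Fin k → Fin l) → Tm l
  | var i, _, ρ => var (ρ i)
  | app t u, _, ρ => app (t.rename ρ) (u.rename ρ)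
  | lam t, _, ρ => lam (t.rename (Fin.cases 0 (fun i => (ρ i).succ)))

/-- Simultaneous capture-avoiding substitution. -/
def subst {k : ℕ} : Tm k → {l : ℕ} → (Fin k → Tm l) → Tm l
  | var i, _, σ => σ i
  | app t u, _, σ => app (t.subst σ) (u.subst σ)
  | lam t, _, σ => lam (t.subst (Fin.cases (var 0) (fun i => (σ i).rename Fin.succ)))

/-- `[u/x]t`, where `x` is the variable of index `0`. -/
def inst {k : ℕ} (t : Tm (k + 1)) (u : Tm k) : Tm k :=
  t.subst (Fin.cases u var)

/-- `t u₁ ⋯ uₘ`. -/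
def apps {k : ℕ} (t : Tm k) (us : List (Tm k)) : Tm k :=
  us.foldl app t

/-- `λ y₁ … yₙ. t`. -/
def lams {k : ℕ} : (n : ℕ) → Tm (k + n) → Tm k
  | 0, t => t
  | n + 1, t => lams n (lam t)

/-- The term `t`, regarded as a term in the scope of `n` further variables (which do not occur
in it). -/
def weaken {k : ℕ} (t : Tm k) (n : ℕ) : Tm (k + n) :=
  t.rename (fun i => i.addNat n)

/-- The list `y₁, …, yₙ` of the variables bound by `lams n`, the outermost one first. -/
def boundVars (k n : ℕ) : List (Tm (k + n)) :=
  List.ofFn fun j : Fin n => var ((Fin.rev j).castLE (Nat.le_add_left n k))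

end Tm

open Tm

/-- One-step `β`-reduction. -/
inductive Beta : {k : ℕ} → Tm k → Tm k → Prop
  | redex {k : ℕ} (b : Tm (k + 1)) (a : Tm k) : Beta (app (lam b) a) (b.inst a)
  | appL {k : ℕ} {t t' : Tm k} (u : Tm k) : Beta t t' → Beta (app t u) (app t' u)
  | appR {k : ℕ} (t : Tm k) {u u' : Tm k} : Beta u u' → Beta (app t u) (app t u')
  | lam {k : ℕ} {t t' : Tm (k + 1)} : Beta t t' → Beta (lam t) (lam t')

/-- One-step `η`-reduction: `λ x. t x` reduces to `t` if `x` is not free in `t`. -/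
inductive Eta : {k : ℕ} → Tm k → Tm k → Prop
  | redex {k : ℕ} (t : Tm k) : Eta (lam (app (t.rename Fin.succ) (var 0))) t
  | appL {k : ℕ} {t t' : Tm k} (u : Tm k) : Eta t t' → Eta (app t u) (app t' u)
  | appR {k : ℕ} (t : Tm k) {u u' : Tm k} : Eta u u' → Eta (app t u) (app t u')
  | lam {k : ℕ} {t t' : Tm (k + 1)} : Eta t t' → Eta (lam t) (lam t')

/-- One-step `βη`-reduction. -/
def BetaEta {k : ℕ} (t u : Tm k) : Prop := Beta t u ∨ Eta t u

/-- `β`-reduction in any number of steps. -/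
def BetaRed {k : ℕ} : Tm k → Tm k → Prop := Relation.ReflTransGen Beta

/-- `η`-reduction in any number of steps. -/
def EtaRed {k : ℕ} : Tm k → Tm k → Prop := Relation.ReflTransGen Eta

/-- `βη`-reduction in any number of steps. -/
def Red {k : ℕ} : Tm k → Tm k → Prop := Relation.ReflTransGen BetaEta

/-- One-step `β`-reduction in which the contracted redex is not the head redex, the head redex of
`λ y₁ … yₙ. (λ y. t) u u₁ ⋯ uₘ` being `(λ y. t) u`. -/
inductive NonHead : {k : ℕ} → Tm k → Tm k → Prop
  | appR {k : ℕ} (t : Tm k) {u u' : Tm k} : Beta u u' → NonHead (app t u) (app t u')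
  | appLam {k : ℕ} {b b' : Tm (k + 1)} (u : Tm k) :
      Beta b b' → NonHead (app (lam b) u) (app (lam b') u)
  | appL {k : ℕ} {t t' : Tm k} (u : Tm k) : NonHead t t' → NonHead (app t u) (app t' u)
  | lam {k : ℕ} {t t' : Tm (k + 1)} : NonHead t t' → NonHead (lam t) (lam t')

/-- `t` is in `βη`-normal form. -/
def IsNormal {k : ℕ} (t : Tm k) : Prop := ∀ u, ¬ BetaEta t u

/-- `J` is the `βη`-normal form of `t` if `t` has one, and `t` itself otherwise. -/
def NormalOrSelf {k : ℕ} (t J : Tm k) : Prop :=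
  (Red t J ∧ IsNormal J) ∨ ((¬ ∃ u, Red t u ∧ IsNormal u) ∧ J = t)

/-- A closed term is a zero-term (has order `0`) if it does not `β`-reduce to an abstraction. -/
def IsZeroTerm (M : Tm 0) : Prop := ∀ b : Tm 1, ¬ BetaRed M (lam b)

/-- A set of closed terms is supercofinal if every closed term has a `βη`-reduct in it and it
contains every closed term that does not `βη`-reduce to a zero-term. -/
def IsSupercofinal (X : Set (Tm 0)) : Prop :=
  (∀ M : Tm 0, ∃ H ∈ X, Red M H) ∧
    ∀ M : Tm 0, (¬ ∃ Z : Tm 0, IsZeroTerm Z ∧ Red M Z) → M ∈ X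

/-- Proofs of `A =_ω B`, for closed `A` and `B`, as well-founded infinitely branching trees.
A proof either ends in an instance of the `ω`-rule, with one premise `P R =_ω Q R` for each closed
term `R`, or in an endpiece in standard form
`A ↠ J₁ ↞ G₁ M₁ =_ω G₁ N₁ ↠ J₂ ↞ ⋯ =_ω G_t N_t ↠ J_{t+1} ↞ B` with `t ≥ 0`, where `↠` is
`βη`-reduction and where every `Mᵢ =_ω Nᵢ` is the direct conclusion of an instance of the
`ω`-rule, whose premises are proved by the trees `leaf i R`. The case `t = 0` is a single
`βη`-conversion. -/
inductive OmegaProof : Tm 0 → Tm 0 → Type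
  | omega {P Q : Tm 0} (prem : ∀ R : Tm 0, OmegaProof (app P R) (app Q R)) : OmegaProof P Q
  | endpiece {A B : Tm 0} (t : ℕ) (J : Fin (t + 1) → Tm 0) (G M N : Fin t → Tm 0)
      (leaf : ∀ (i : Fin t) (R : Tm 0), OmegaProof (app (M i) R) (app (N i) R))
      (start : Red A (J 0))
      (left : ∀ i : Fin t, Red (app (G i) (M i)) (J i.castSucc))
      (right : ∀ i : Fin t, Red (app (G i) (N i)) (J i.succ))
      (finish : Red B (J (Fin.last t))) : OmegaProof A B

/-- The Hessenberg sum of two ordinals: the coefficients of the Cantor normal forms to the base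
`ω` are added. -/
noncomputable def hadd (a b : Ordinal.{0}) : Ordinal.{0} :=
  Ordinal.CNF.eval Ordinal.omega0
    (Ordinal.CNF.coeff Ordinal.omega0 a + Ordinal.CNF.coeff Ordinal.omega0 b)

/-- The Hessenberg sum of a finite list of ordinals. -/
noncomputable def hsum (l : List Ordinal.{0}) : Ordinal.{0} := l.foldr hadd 0

/-- The ordinal of an instance of the `ω`-rule whose premise for the closed term `R` has a proof
of ordinal `f R`: it is `ω ^ θ` with `θ` the supremum of all Hessenberg sums of the ordinals of
finitely many different premises. (This is the supremum of the sums over the initial segments of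
any enumeration of the premises.) -/
noncomputable def omegaOrd (f : Tm 0 → Ordinal.{0}) : Ordinal.{0} :=
  Ordinal.omega0 ^ (⨆ l : {l : List (Tm 0) // l.Nodup}, hsum (l.1.map f))

/-- `x` being the only free variable of `Y`, `L₁, …, Lₘ` apart from the variable `y` of `λ y. Y`,
this is the condition on a component `H ↞ G M =_ω G N ↠ H'` of a canonical endpiece, with
`G ≡ λ x. λ y₁ … yₙ. ((λ y. Y) L₁ ⋯ Lₘ) Z₁ ⋯ Zₙ`, where `m, n ≥ 0`.
The terms `Y`, `L₁, …, Lₘ` do not contain `y₁, …, yₙ`: otherwise there would be no `η`-reduction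
as in the condition on the right facing arrow. -/
def CanonicalComponent (G M N H H' : Tm 0) : Prop :=
  ∃ (n : ℕ) (Y : Tm 2) (L : List (Tm 1)) (Z : Fin n → Tm (1 + n)),
    let core : Tm 1 := apps (lam Y) L
    let body : Tm 1 := lams n (apps (core.weaken n) (List.ofFn Z))
    G = lam body ∧
    -- the left facing arrow: the step from `G M` to `[M/x] body`, then non-head `β`, then `η`
    (∃ V : Tm 0, Relation.ReflTransGen NonHead (body.inst M) V ∧ EtaRed V H) ∧
    -- the right facing arrow: the step from `G N` to `[N/x] body`, then as follows
    Red (body.inst N) (lams n (apps ((core.inst N).weaken n) (boundVars 0 n))) ∧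
    EtaRed (lams n (apps ((core.inst N).weaken n) (boundVars 0 n))) (core.inst N) ∧
    ∃ (J₀ : Tm 0) (Js : List (Tm 0)),
      NormalOrSelf ((lam Y).inst N) J₀ ∧
      List.Forall₂ NormalOrSelf (L.map fun l => l.inst N) Js ∧
      Red (core.inst N) (apps J₀ Js) ∧
      Red (apps J₀ Js) H'

namespace OmegaProof

/-- The proof ends in an endpiece. -/
def EndsInEndpiece {A B : Tm 0} : OmegaProof A B → Prop
  | omega _ => False
  | endpiece .. => True

/-- The ordinal of a proof. -/
noncomputable def ord : {A B : Tm 0} → OmegaProof A B → Ordinal.{0}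
  | _, _, omega prem => omegaOrd fun R => (prem R).ord
  | _, _, endpiece t _ _ _ _ leaf _ _ _ _ =>
      hadd 1 (hsum (List.ofFn fun i : Fin t => omegaOrd fun R => (leaf i R).ord))

/-- The rank of a proof that ends in an endpiece: the maximum of the ordinals of the proofs of the
leaves `Mᵢ =_ω Nᵢ`. It is `0` exactly for an endpiece that consists of a single `βη`-conversion.
(The value at a proof that ends in an instance of the `ω`-rule is irrelevant.) -/
noncomputable def rank : {A B : Tm 0} → OmegaProof A B → Ordinal.{0}
  | _, _, omega _ => 0
  | _, _, endpiece t _ _ _ _ leaf _ _ _ _ => ⨆ i : Fin t, (omega (leaf i)).ord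

/-- `X`-canonical proofs. -/
def IsCanonical (X : Set (Tm 0)) : {A B : Tm 0} → OmegaProof A B → Prop
  | _, _, omega prem => ∀ R, (prem R).IsCanonical X
  | _, _, endpiece t J G M N leaf _ _ _ _ =>
      (∀ i, J i ∈ X) ∧
      (∀ i : Fin t, CanonicalComponent (G i) (M i) (N i) (J i.castSucc) (J i.succ)) ∧
      ∀ (i : Fin t) (R : Tm 0), (leaf i R).IsCanonical X

end OmegaProof

end LamOmega

namespace LamOmega

open Tm Relation

/-! ### Substitution -/

/-! Appending arguments `Q` to every term of the endpiece keeps it a chain of equations, but spoils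
canonicity: `Gᵢ Mᵢ Q` need not lie in `X`, and the right arrows must pass through normal forms. The
repair replaces the old components by ones of the shape `component E = λ x. λ y. E y`. Their left
arrow ends in `E[M]` after one `η`-step, and their right arrow starts from `λ y. E[N] y`, so
everything reduces to finding open terms `E` such that `E[Mᵢ]` lies in `X` and has no normal form,
while `E[b]` agrees with `Gᵢ b Q` on all closed arguments.

Supercofinality puts a closed term in `X` once it has no zero-term among its reducts. By
`exists_apps_isZeroTerm_or` finitely many arguments `S` can be chosen such that each `Gᵢ Mᵢ P S`
either is a zero-term or cannot be made one by any further arguments. In the second case applying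
one more argument changes nothing, and the term lies in `X` and has no normal form, because normal
terms can be made zero-terms (`IsNormal.zeroAble`). In the first case a zero-term `B` is replaced by
`guarded B T = λ z. B T z`, where `T` is Plotkin's term: `z` can never be erased from it, yet all
its closed instances are convertible to one closed term `W`. No reduct of `λ z. B T z` can be
`η`-contracted at the root, and `B` stays a zero-term, so every reduct is an abstraction and retains
a redex from `B` (`red_guarded`). Applied to a closed `c` it converts to `B W c`. Hence the witness
is `S` followed by `W`.

The passages between the old terms and the new ones are leaves whose premises are conversions. Their
ordinal `convOrd` is the least that any `ω`-rule can have (`omegaOrd_one_le`), so if the endpiece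
has a leaf at all the rank is unchanged. An endpiece without leaves remains a single conversion.

Plotkin's term needs a `λ`-definable enumeration of the closed terms up to conversion, obtained from
`K`, `S` and a stream of stacks. That its variable survives is proved by a system of kinds preserved
under `β` (`HasKind.of_beta`), combined with the postponement of `η`. -/

/-- Lifting of a renaming under a binder. -/
def upr {k l : ℕ} (ρ : Fin k → Fin l) : Fin (k + 1) → Fin (l + 1) :=
  Fin.cases 0 (fun i => (ρ i).succ)

/-- Extension of a substitution by a value for the variable of index `0`. -/
def scons {k l : ℕ} (u : Tm l) (σ : Fin k → Tm l) : Fin (k + 1) → Tm l :=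
  Fin.cases u σ

/-- Lifting of a substitution under a binder. -/
def ups {k l : ℕ} (σ : Fin k → Tm l) : Fin (k + 1) → Tm (l + 1) :=
  scons (var 0) (fun i => (σ i).rename Fin.succ)

section simps
variable {k l m : ℕ}

@[simp] lemma upr_zero (ρ : Fin k → Fin l) : upr ρ 0 = 0 := rfl
@[simp] lemma upr_succ (ρ : Fin k → Fin l) (i : Fin k) : upr ρ i.succ = (ρ i).succ := rfl
@[simp] lemma scons_zero (u : Tm l) (σ : Fin k → Tm l) : scons u σ 0 = u := rfl
@[simp] lemma scons_succ (u : Tm l) (σ : Fin k → Tm l) (i : Fin k) :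
    scons u σ i.succ = σ i := rfl
@[simp] lemma ups_zero (σ : Fin k → Tm l) : ups σ 0 = var 0 := rfl
@[simp] lemma ups_succ (σ : Fin k → Tm l) (i : Fin k) :
    ups σ i.succ = (σ i).rename Fin.succ := rfl
@[simp] lemma rename_var (ρ : Fin k → Fin l) (i : Fin k) : (var i).rename ρ = var (ρ i) := rfl
@[simp] lemma rename_app (ρ : Fin k → Fin l) (t u : Tm k) :
    (app t u).rename ρ = app (t.rename ρ) (u.rename ρ) := rfl
@[simp] lemma rename_lam (ρ : Fin k → Fin l) (t : Tm (k + 1)) :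
    (lam t).rename ρ = lam (t.rename (upr ρ)) := rfl
@[simp] lemma subst_var (σ : Fin k → Tm l) (i : Fin k) : (var i).subst σ = σ i := rfl
@[simp] lemma subst_app (σ : Fin k → Tm l) (t u : Tm k) :
    (app t u).subst σ = app (t.subst σ) (u.subst σ) := rfl
@[simp] lemma subst_lam (σ : Fin k → Tm l) (t : Tm (k + 1)) :
    (lam t).subst σ = lam (t.subst (ups σ)) := rfl

lemma inst_eq (t : Tm (k + 1)) (u : Tm k) : t.inst u = t.subst (scons u var) := rfl

lemma upr_comp (ρ : Fin k → Fin l) (τ : Fin l → Fin m) : upr τ ∘ upr ρ = upr (τ ∘ ρ) := by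
  funext i; refine Fin.cases ?_ (fun i => ?_) i <;> rfl

lemma ups_comp_upr (ρ : Fin k → Fin l) (σ : Fin l → Tm m) : ups σ ∘ upr ρ = ups (σ ∘ ρ) := by
  funext i; refine Fin.cases ?_ (fun i => ?_) i <;> rfl

lemma ups_var : ups (var : Fin k → Tm k) = var := by
  funext i; refine Fin.cases ?_ (fun i => ?_) i <;> rfl

lemma ups_comp_var (ρ : Fin k → Fin l) : ups (fun i => var (ρ i)) = fun i => var (upr ρ i) := by
  funext i; refine Fin.cases ?_ (fun i => ?_) i <;> rfl

end simps

lemma rename_rename {k l m : ℕ} (t : Tm k) (ρ : Fin k → Fin l) (τ : Fin l → Fin m) :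
    (t.rename ρ).rename τ = t.rename (τ ∘ ρ) := by
  induction t generalizing l m with
  | var i => rfl
  | app t u iht ihu => simp [iht, ihu]
  | lam t ih => simp [ih, upr_comp]

lemma rename_subst {k l m : ℕ} (t : Tm k) (ρ : Fin k → Fin l) (σ : Fin l → Tm m) :
    (t.rename ρ).subst σ = t.subst (σ ∘ ρ) := by
  induction t generalizing l m with
  | var i => rfl
  | app t u iht ihu => simp [iht, ihu]
  | lam t ih => simp [ih, ups_comp_upr]

lemma ups_rename {k l m : ℕ} (σ : Fin k → Tm l) (ρ : Fin l → Fin m) :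
    (fun i => (ups σ i).rename (upr ρ)) = ups (fun i => (σ i).rename ρ) := by
  funext i
  refine Fin.cases rfl (fun i => ?_) i
  simp only [ups_succ, rename_rename]
  rfl

lemma subst_rename {k l m : ℕ} (t : Tm k) (σ : Fin k → Tm l) (ρ : Fin l → Fin m) :
    (t.subst σ).rename ρ = t.subst (fun i => (σ i).rename ρ) := by
  induction t generalizing l m with
  | var i => rfl
  | app t u iht ihu => simp [iht, ihu]
  | lam t ih => simp [ih, ups_rename]

lemma ups_subst {k l m : ℕ} (σ : Fin k → Tm l) (τ : Fin l → Tm m) :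
    (fun i => (ups σ i).subst (ups τ)) = ups (fun i => (σ i).subst τ) := by
  funext i
  refine Fin.cases rfl (fun i => ?_) i
  simp only [ups_succ, rename_subst, subst_rename]
  rfl

lemma subst_subst {k l m : ℕ} (t : Tm k) (σ : Fin k → Tm l) (τ : Fin l → Tm m) :
    (t.subst σ).subst τ = t.subst (fun i => (σ i).subst τ) := by
  induction t generalizing l m with
  | var i => rfl
  | app t u iht ihu => simp [iht, ihu]
  | lam t ih => simp [ih, ups_subst]

@[simp] lemma subst_id {k : ℕ} (t : Tm k) : t.subst var = t := by
  induction t with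
  | var i => rfl
  | app t u iht ihu => simp [iht, ihu]
  | lam t ih => simp [ups_var, ih]

lemma rename_eq_subst {k l : ℕ} (t : Tm k) (ρ : Fin k → Fin l) :
    t.rename ρ = t.subst (fun i => var (ρ i)) := by
  induction t generalizing l with
  | var i => rfl
  | app t u iht ihu => simp [iht, ihu]
  | lam t ih => simp [ih, ups_comp_var]

@[simp] lemma rename_id {k : ℕ} (t : Tm k) : t.rename id = t := by
  rw [rename_eq_subst]; exact subst_id t

@[simp] lemma rename_succ_subst_scons {k l : ℕ} (t : Tm k) (u : Tm l) (σ : Fin k → Tm l) :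
    (t.rename Fin.succ).subst (scons u σ) = t.subst σ := by
  rw [rename_subst]; rfl

@[simp] lemma rename_succ_inst {k : ℕ} (t u : Tm k) : (t.rename Fin.succ).inst u = t := by
  rw [inst_eq, rename_succ_subst_scons, subst_id]

lemma rename_succ_subst_ups {k l : ℕ} (t : Tm k) (σ : Fin k → Tm l) :
    (t.rename Fin.succ).subst (ups σ) = (t.subst σ).rename Fin.succ := by
  rw [rename_subst, subst_rename]; rfl

lemma rename_succ_rename_upr {k l : ℕ} (t : Tm k) (ρ : Fin k → Fin l) :
    (t.rename Fin.succ).rename (upr ρ) = (t.rename ρ).rename Fin.succ := by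
  rw [rename_rename, rename_rename]; rfl

lemma subst_ups_inst {k l : ℕ} (t : Tm (k + 1)) (σ : Fin k → Tm l) (u : Tm l) :
    (t.subst (ups σ)).inst u = t.subst (scons u σ) := by
  rw [inst_eq, subst_subst]
  congr 1
  funext i
  refine Fin.cases rfl (fun i => ?_) i
  simp

lemma subst_scons_subst {k l m : ℕ} (t : Tm (k + 1)) (u : Tm l) (σ : Fin k → Tm l)
    (τ : Fin l → Tm m) :
    (t.subst (scons u σ)).subst τ = t.subst (scons (u.subst τ) fun i => (σ i).subst τ) := by
  rw [subst_subst]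
  congr 1
  funext i
  refine Fin.cases rfl (fun i => rfl) i

lemma inst_subst {k l : ℕ} (t : Tm (k + 1)) (u : Tm k) (σ : Fin k → Tm l) :
    (t.inst u).subst σ = (t.subst (ups σ)).inst (u.subst σ) := by
  rw [subst_ups_inst, inst_eq, subst_scons_subst]; rfl

lemma inst_rename {k l : ℕ} (t : Tm (k + 1)) (u : Tm k) (ρ : Fin k → Fin l) :
    (t.inst u).rename ρ = (t.rename (upr ρ)).inst (u.rename ρ) := by
  simp only [rename_eq_subst, inst_subst, ups_comp_var]

lemma rename_upr_succ_inst_var {k : ℕ} (t : Tm (k + 1)) :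
    (t.rename (upr Fin.succ)).inst (var 0) = t := by
  rw [inst_eq, rename_subst]
  convert subst_id t using 2
  funext i
  refine Fin.cases rfl (fun i => rfl) i

lemma rename_succ_injective {k : ℕ} :
    Function.Injective fun t : Tm k => t.rename Fin.succ := by
  intro t u h
  have := congrArg (fun v : Tm (k + 1) => v.inst (lam (var 0))) h
  simpa using this

/-- A term that is both a lifting and a renaming along a lifted map is the lifting of a renaming. -/
lemma eq_rename_succ_of_rename_upr {k l : ℕ} {ρ : Fin k → Fin l} {t : Tm (k + 1)} {s : Tm l}
    (h : t.rename (upr ρ) = s.rename Fin.succ) :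
    ∃ t' : Tm k, t = t'.rename Fin.succ ∧ t'.rename ρ = s := by
  -- Generalised to four renamings forming a weak pullback square, a condition that is stable under
  -- lifting below a binder.
  suffices H : ∀ {k l k' m : ℕ} (t : Tm m) (s : Tm l) (a : Fin m → Fin k') (b : Fin l → Fin k')
      (c : Fin k → Fin m) (d : Fin k → Fin l),
      (∀ i j, a i = b j → ∃ x, i = c x ∧ d x = j) → t.rename a = s.rename b →
      ∃ t' : Tm k, t = t'.rename c ∧ t'.rename d = s by
    refine H t s _ _ Fin.succ ρ (fun i j => ?_) h
    refine Fin.cases (fun h => absurd h.symm (Fin.succ_ne_zero _)) (fun i h => ?_) i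
    exact ⟨i, rfl, Fin.succ_injective _ h⟩
  clear h s t ρ
  intro k l k' m t
  induction t generalizing k l k' with
  | var i =>
    intro s a b c d hp h
    cases s <;> simp at h
    obtain ⟨x, hx, hx'⟩ := hp _ _ h
    exact ⟨var x, by simp [hx], by simp [hx']⟩
  | app t u iht ihu =>
    intro s a b c d hp h
    cases s <;> simp at h
    obtain ⟨t', rfl, rfl⟩ := iht _ a b c d hp h.1
    obtain ⟨u', rfl, rfl⟩ := ihu _ a b c d hp h.2
    exact ⟨app t' u', rfl, rfl⟩
  | lam t ih =>
    intro s a b c d hp h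
    cases s <;> simp at h
    obtain ⟨t', rfl, rfl⟩ := ih _ (upr a) (upr b) (upr c) (upr d) (fun i j => by
      refine Fin.cases ?_ (fun i => ?_) i <;> refine Fin.cases ?_ (fun j => ?_) j <;> intro h
      · exact ⟨0, rfl, rfl⟩
      · exact absurd h (Fin.succ_ne_zero _).symm
      · exact absurd h (Fin.succ_ne_zero _)
      · obtain ⟨x, hx, hx'⟩ := hp _ _ (Fin.succ_injective _ h)
        exact ⟨x.succ, congrArg Fin.succ hx, congrArg Fin.succ hx'⟩) h
    exact ⟨lam t', rfl, rfl⟩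

lemma app_var_inst {k : ℕ} (t a : Tm k) :
    (Tm.app (t.rename Fin.succ) (var 0)).inst a = Tm.app t a :=
  congrArg (fun s => Tm.app s a) (rename_succ_inst t a)

/-! ### Compatibility of the reductions with contexts and substitutions -/

lemma BetaRed.appL {k : ℕ} {t t' : Tm k} (u : Tm k) (h : BetaRed t t') :
    BetaRed (app t u) (app t' u) :=
  ReflTransGen.lift (fun t => app t u) (fun _ _ h => Beta.appL u h) _ _ h

lemma BetaRed.appR {k : ℕ} (t : Tm k) {u u' : Tm k} (h : BetaRed u u') :
    BetaRed (app t u) (app t u') :=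
  ReflTransGen.lift (fun u => app t u) (fun _ _ h => Beta.appR t h) _ _ h

lemma BetaRed.mkApp {k : ℕ} {t t' u u' : Tm k} (h : BetaRed t t') (h' : BetaRed u u') :
    BetaRed (app t u) (app t' u') :=
  (h.appL u).trans (BetaRed.appR t' h')

lemma BetaRed.lam {k : ℕ} {t t' : Tm (k + 1)} (h : BetaRed t t') : BetaRed (lam t) (lam t') :=
  ReflTransGen.lift Tm.lam (fun _ _ h => Beta.lam h) _ _ h

lemma EtaRed.appL {k : ℕ} {t t' : Tm k} (u : Tm k) (h : EtaRed t t') :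
    EtaRed (Tm.app t u) (Tm.app t' u) :=
  ReflTransGen.lift (fun t => Tm.app t u) (fun _ _ h => Eta.appL u h) _ _ h

lemma EtaRed.appR {k : ℕ} (t : Tm k) {u u' : Tm k} (h : EtaRed u u') :
    EtaRed (Tm.app t u) (Tm.app t u') :=
  ReflTransGen.lift (fun u => Tm.app t u) (fun _ _ h => Eta.appR t h) _ _ h

lemma EtaRed.lam {k : ℕ} {t t' : Tm (k + 1)} (h : EtaRed t t') : EtaRed (Tm.lam t) (Tm.lam t') :=
  ReflTransGen.lift Tm.lam (fun _ _ h => Eta.lam h) _ _ h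

lemma BetaRed.red {k : ℕ} {t u : Tm k} (h : BetaRed t u) : Red t u :=
  ReflTransGen.mono (r := Beta) (p := BetaEta) (fun _ _ h => Or.inl h) _ _ h

lemma EtaRed.red {k : ℕ} {t u : Tm k} (h : EtaRed t u) : Red t u :=
  ReflTransGen.mono (r := Eta) (p := BetaEta) (fun _ _ h => Or.inr h) _ _ h

lemma Red.appL {k : ℕ} {t t' : Tm k} (u : Tm k) (h : Red t t') : Red (app t u) (app t' u) :=
  ReflTransGen.lift (p := BetaEta) (fun t => Tm.app t u)
    (fun _ _ (h : BetaEta _ _) => h.imp (Beta.appL u) (Eta.appL u)) _ _ h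

lemma Red.apps {t t' : Tm 0} (h : Red t t') (us : List (Tm 0)) : Red (t.apps us) (t'.apps us) := by
  induction us generalizing t t' with
  | nil => exact h
  | cons u us ih => exact ih (h.appL u)

lemma Beta.rename {k l : ℕ} {t u : Tm k} (h : Beta t u) (ρ : Fin k → Fin l) :
    Beta (t.rename ρ) (u.rename ρ) := by
  induction h generalizing l with
  | redex b a => rw [inst_rename]; exact .redex _ _
  | appL u _ ih => exact .appL _ (ih ρ)
  | appR t _ ih => exact .appR _ (ih ρ)
  | lam _ ih => exact .lam (ih _)

lemma BetaRed.rename {k l : ℕ} {t u : Tm k} (h : BetaRed t u) (ρ : Fin k → Fin l) :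
    BetaRed (t.rename ρ) (u.rename ρ) :=
  ReflTransGen.lift (p := Beta) (fun t => Tm.rename t ρ) (fun _ _ h => Beta.rename h ρ) _ _ h

lemma Beta.apps {k : ℕ} {t t' : Tm k} (h : Beta t t') (us : List (Tm k)) :
    Beta (t.apps us) (t'.apps us) := by
  induction us generalizing t t' with
  | nil => exact h
  | cons u us ih => exact ih (h.appL u)

/-- A `β`-step from a renamed term comes from a step of the term. -/
lemma Beta.of_rename {k l : ℕ} {t : Tm k} {ρ : Fin k → Fin l} {s : Tm l}
    (h : Beta (t.rename ρ) s) : ∃ s', s = s'.rename ρ ∧ Beta t s' := by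
  induction t generalizing l with
  | var i => nomatch h
  | lam t ih =>
    cases h with
    | lam h =>
      obtain ⟨s', rfl, h'⟩ := ih h
      exact ⟨Tm.lam s', rfl, .lam h'⟩
  | app t u iht ihu =>
    simp only [rename_app] at h
    generalize hx : t.rename ρ = x at h
    cases h with
    | redex b a =>
      cases t <;> simp at hx
      rename_i t
      subst hx
      exact ⟨t.inst u, (inst_rename _ _ _).symm, .redex _ _⟩
    | appL _ h =>
      subst hx
      obtain ⟨s', rfl, h'⟩ := iht h
      exact ⟨app s' u, rfl, .appL _ h'⟩
    | appR _ h =>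
      subst hx
      obtain ⟨s', rfl, h'⟩ := ihu h
      exact ⟨app t s', rfl, .appR _ h'⟩

/-! ### Parallel `β`-reduction and confluence of `β` -/

/-- Parallel `β`-reduction. -/
inductive PBeta : {k : ℕ} → Tm k → Tm k → Prop
  | var {k : ℕ} (i : Fin k) : PBeta (var i) (var i)
  | app {k : ℕ} {t t' u u' : Tm k} : PBeta t t' → PBeta u u' → PBeta (app t u) (app t' u')
  | lam {k : ℕ} {t t' : Tm (k + 1)} : PBeta t t' → PBeta (lam t) (lam t')
  | redex {k : ℕ} {b b' : Tm (k + 1)} {a a' : Tm k} :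
      PBeta b b' → PBeta a a' → PBeta (Tm.app (Tm.lam b) a) (b'.inst a')

lemma PBeta.refl {k : ℕ} (t : Tm k) : PBeta t t := by
  induction t with
  | var i => exact .var i
  | app t u iht ihu => exact .app iht ihu
  | lam t ih => exact .lam ih

lemma Beta.pbeta {k : ℕ} {t u : Tm k} (h : Beta t u) : PBeta t u := by
  induction h with
  | redex b a => exact .redex (.refl _) (.refl _)
  | appL u _ ih => exact .app ih (.refl _)
  | appR t _ ih => exact .app (.refl _) ih
  | lam _ ih => exact .lam ih

lemma PBeta.betaRed {k : ℕ} {t u : Tm k} (h : PBeta t u) : BetaRed t u := by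
  induction h with
  | var i => exact .refl
  | app _ _ iht ihu => exact iht.mkApp ihu
  | lam _ ih => exact ih.lam
  | redex _ _ ihb iha => exact (ihb.lam.mkApp iha).tail (.redex _ _)

lemma PBeta.rename {k l : ℕ} {t u : Tm k} (h : PBeta t u) (ρ : Fin k → Fin l) :
    PBeta (t.rename ρ) (u.rename ρ) := by
  induction h generalizing l with
  | var i => exact .var _
  | app _ _ iht ihu => exact .app (iht ρ) (ihu ρ)
  | lam _ ih => exact .lam (ih _)
  | redex _ _ ihb iha => rw [inst_rename]; exact .redex (ihb _) (iha _)

lemma PBeta.subst {k l : ℕ} {t u : Tm k} (h : PBeta t u) {σ τ : Fin k → Tm l}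
    (hσ : ∀ i, PBeta (σ i) (τ i)) : PBeta (t.subst σ) (u.subst τ) := by
  have key : ∀ {k l : ℕ} {σ τ : Fin k → Tm l}, (∀ i, PBeta (σ i) (τ i)) →
      ∀ i, PBeta (ups σ i) (ups τ i) := fun h i =>
    Fin.cases (.var _) (fun i => (h i).rename _) i
  induction h generalizing l with
  | var i => exact hσ i
  | app _ _ iht ihu => exact .app (iht hσ) (ihu hσ)
  | lam _ ih => exact .lam (ih (key hσ))
  | redex _ _ ihb iha => rw [inst_subst]; exact .redex (ihb (key hσ)) (iha hσ)

lemma PBeta.inst {k : ℕ} {b b' : Tm (k + 1)} {a a' : Tm k} (hb : PBeta b b') (ha : PBeta a a') :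
    PBeta (b.inst a) (b'.inst a') :=
  hb.subst fun i => Fin.cases ha (fun i => .var i) i

lemma PBeta.diamond {k : ℕ} {t u v : Tm k} (hu : PBeta t u) (hv : PBeta t v) :
    ∃ w, PBeta u w ∧ PBeta v w := by
  induction hu with
  | var i => exact ⟨v, hv, .refl _⟩
  | lam _ ih =>
    cases hv with
    | lam hv =>
      obtain ⟨w, h, h'⟩ := ih hv
      exact ⟨_, .lam h, .lam h'⟩
  | app h1 _ iht ihu =>
    cases hv with
    | app ht hu =>
      obtain ⟨w, h, h'⟩ := iht ht
      obtain ⟨x, g, g'⟩ := ihu hu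
      exact ⟨_, .app h g, .app h' g'⟩
    | redex hb ha =>
      obtain ⟨x, g, g'⟩ := ihu ha
      obtain ⟨w, h, h'⟩ := iht (.lam hb)
      cases h1 with
      | lam h1 =>
        cases h' with
        | lam h' =>
          cases h with
          | lam h => exact ⟨_, .redex h g, h'.inst g'⟩
  | redex _ _ ihb iha =>
    cases hv with
    | app ht hu =>
      cases ht with
      | lam ht =>
        obtain ⟨w, h, h'⟩ := ihb ht
        obtain ⟨x, g, g'⟩ := iha hu
        exact ⟨_, h.inst g, .redex h' g'⟩
    | redex hb ha =>
      obtain ⟨w, h, h'⟩ := ihb hb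
      obtain ⟨x, g, g'⟩ := iha ha
      exact ⟨_, h.inst g, h'.inst g'⟩

lemma BetaRed.pbeta {k : ℕ} {t u : Tm k} (h : BetaRed t u) : ReflTransGen PBeta t u :=
  ReflTransGen.mono (r := Beta) (fun _ _ h => Beta.pbeta h) _ _ h

lemma betaRed_of_pbeta {k : ℕ} {t u : Tm k} (h : ReflTransGen PBeta t u) : BetaRed t u := by
  induction h with
  | refl => exact .refl
  | tail _ h ih => exact ih.trans h.betaRed

theorem BetaRed.confluent {k : ℕ} {t u v : Tm k} (hu : BetaRed t u) (hv : BetaRed t v) :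
    ∃ w, BetaRed u w ∧ BetaRed v w := by
  obtain ⟨w, h, h'⟩ := church_rosser (r := PBeta (k := k)) (fun a b c h h' => by
    obtain ⟨w, h, h'⟩ := h.diamond h'
    exact ⟨w, .single h, .single h'⟩) hu.pbeta hv.pbeta
  exact ⟨w, betaRed_of_pbeta h, betaRed_of_pbeta h'⟩

/-! ### Parallel `η`-reduction -/

/-- Parallel `η`-reduction. -/
inductive PEta : {k : ℕ} → Tm k → Tm k → Prop
  | var {k : ℕ} (i : Fin k) : PEta (var i) (var i)
  | app {k : ℕ} {t t' u u' : Tm k} : PEta t t' → PEta u u' → PEta (app t u) (app t' u')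
  | lam {k : ℕ} {t t' : Tm (k + 1)} : PEta t t' → PEta (lam t) (lam t')
  | eta {k : ℕ} {t t' : Tm k} :
      PEta t t' → PEta (Tm.lam (Tm.app (t.rename Fin.succ) (Tm.var 0))) t'

lemma PEta.refl {k : ℕ} (t : Tm k) : PEta t t := by
  induction t with
  | var i => exact .var i
  | app t u iht ihu => exact .app iht ihu
  | lam t ih => exact .lam ih

lemma Eta.peta {k : ℕ} {t u : Tm k} (h : Eta t u) : PEta t u := by
  induction h with
  | redex t => exact .eta (.refl _)
  | appL u _ ih => exact .app ih (.refl _)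
  | appR t _ ih => exact .app (.refl _) ih
  | lam _ ih => exact .lam ih

lemma PEta.etaRed {k : ℕ} {t u : Tm k} (h : PEta t u) : EtaRed t u := by
  induction h with
  | var i => exact .refl
  | app _ _ iht ihu => exact (iht.appL _).trans (ihu.appR _)
  | lam _ ih => exact ih.lam
  | eta _ ih => exact .head (.redex _) ih

lemma PEta.rename {k l : ℕ} {t u : Tm k} (h : PEta t u) (ρ : Fin k → Fin l) :
    PEta (t.rename ρ) (u.rename ρ) := by
  induction h generalizing l with
  | var i => exact .var _
  | app _ _ iht ihu => exact .app (iht ρ) (ihu ρ)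
  | lam _ ih => exact .lam (ih _)
  | eta _ ih =>
    simp only [rename_lam, rename_app, rename_succ_rename_upr, rename_var, upr_zero]
    exact .eta (ih ρ)

lemma PEta.subst {k l : ℕ} {t u : Tm k} (h : PEta t u) {σ τ : Fin k → Tm l}
    (hσ : ∀ i, PEta (σ i) (τ i)) : PEta (t.subst σ) (u.subst τ) := by
  induction h generalizing l with
  | var i => exact hσ i
  | app _ _ iht ihu => exact .app (iht hσ) (ihu hσ)
  | lam _ ih => exact .lam (ih fun i => Fin.cases (.var _) (fun i => (hσ i).rename _) i)
  | eta _ ih =>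
    simp only [subst_lam, subst_app, rename_succ_subst_ups, subst_var, ups_zero]
    exact .eta (ih hσ)

lemma PEta.inst {k : ℕ} {b b' : Tm (k + 1)} {a a' : Tm k} (hb : PEta b b') (ha : PEta a a') :
    PEta (b.inst a) (b'.inst a') :=
  hb.subst fun i => Fin.cases ha (fun i => .var i) i

/-- A parallel `η`-step from a renamed term comes from a step of the term. -/
lemma PEta.of_rename {k l : ℕ} {t : Tm k} {ρ : Fin k → Fin l} {s : Tm l}
    (h : PEta (t.rename ρ) s) : ∃ s', s = s'.rename ρ ∧ PEta t s' := by
  generalize hx : t.rename ρ = x at h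
  induction h generalizing k with
  | var i =>
    cases t <;> simp at hx
    exact ⟨_, by rw [← hx]; rfl, .var _⟩
  | app _ _ iht ihu =>
    cases t <;> simp at hx
    obtain ⟨s, rfl, hs⟩ := iht hx.1
    obtain ⟨s', rfl, hs'⟩ := ihu hx.2
    exact ⟨_, rfl, .app hs hs'⟩
  | lam _ ih =>
    cases t <;> simp at hx
    obtain ⟨s, rfl, hs⟩ := ih hx
    exact ⟨_, rfl, .lam hs⟩
  | eta _ ih =>
    rename_i s s' _
    cases t with
    | var i => simp at hx
    | app t u => simp at hx
    | lam t =>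
      cases t with
      | var i => simp at hx
      | lam t => simp at hx
      | app t u =>
        cases u with
        | app u v => simp at hx
        | lam u => simp at hx
        | var i =>
          simp only [rename_lam, rename_app, rename_var, lam.injEq, app.injEq, var.injEq] at hx
          obtain ⟨t', rfl, ht'⟩ := eq_rename_succ_of_rename_upr hx.1
          obtain ⟨s, rfl, hs⟩ := ih ht'
          refine ⟨s, rfl, ?_⟩
          have : i = 0 := by
            revert hx
            refine Fin.cases (fun _ => rfl) (fun i h => ?_) i
            exact absurd h.2 (Fin.succ_ne_zero _)
          rw [this]
          exact .eta hs

lemma PEta.app_var_inv {k : ℕ} {s : Tm k} {w : Tm (k + 1)}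
    (h : PEta (Tm.app (s.rename Fin.succ) (Tm.var 0)) w) :
    ∃ s', w = Tm.app (s'.rename Fin.succ) (Tm.var 0) ∧ PEta s s' := by
  generalize hx : s.rename Fin.succ = x at h
  cases h with
  | app h h' =>
    subst hx
    cases h'
    obtain ⟨s', rfl, hs⟩ := h.of_rename
    exact ⟨s', rfl, hs⟩

lemma PEta.lam_inv {k : ℕ} {b : Tm (k + 1)} {v : Tm k} (h : PEta (Tm.lam b) v) :
    (∃ b', v = Tm.lam b' ∧ PEta b b') ∨
      ∃ s, b = Tm.app (s.rename Fin.succ) (Tm.var 0) ∧ PEta s v := by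
  cases h with
  | lam h => exact .inl ⟨_, rfl, h⟩
  | eta h => exact .inr ⟨_, rfl, h⟩

lemma PEta.diamond {k : ℕ} {t u v : Tm k} (hu : PEta t u) (hv : PEta t v) :
    ∃ w, PEta u w ∧ PEta v w := by
  induction hu with
  | var i => exact ⟨v, hv, .refl _⟩
  | app _ _ iht ihu =>
    cases hv with
    | app ht hu =>
      obtain ⟨w, h, h'⟩ := iht ht
      obtain ⟨x, g, g'⟩ := ihu hu
      exact ⟨_, .app h g, .app h' g'⟩
  | lam h1 ih =>
    obtain ⟨b', rfl, hb⟩ | ⟨s, rfl, hs⟩ := hv.lam_inv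
    · obtain ⟨w, h, h'⟩ := ih hb
      exact ⟨_, .lam h, .lam h'⟩
    · obtain ⟨x, rfl, _⟩ := h1.app_var_inv
      -- The body `s x` keeps its shape under parallel steps, so the `η`-step of `s` can be closed
      -- against the given step inside the body.
      obtain ⟨w, h, h'⟩ := ih (.app (hs.rename Fin.succ) (.var 0))
      obtain ⟨y, rfl, hy⟩ := h.app_var_inv
      obtain ⟨y', h2, hy'⟩ := h'.app_var_inv
      simp only [app.injEq, and_true] at h2
      rw [← rename_succ_injective h2] at hy'
      exact ⟨y, .eta hy, hy'⟩
  | eta h1 ih =>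
    obtain ⟨b', rfl, hb⟩ | ⟨s, h, hs⟩ := hv.lam_inv
    · obtain ⟨x, rfl, hx⟩ := hb.app_var_inv
      obtain ⟨w, h, h'⟩ := ih hx
      exact ⟨w, h, .eta h'⟩
    · simp only [app.injEq, and_true] at h
      rw [← rename_succ_injective h] at hs
      exact ih hs

/-- `β` and `η` commute. -/
lemma Beta.commute_peta {k : ℕ} {t u v : Tm k} (hv : PEta t v) (hu : Beta t u) :
    ∃ w, PEta u w ∧ BetaRed v w := by
  induction hv with
  | var i => nomatch hu
  | app h1 h2 iht ihu =>
    cases hu with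
    | redex b a =>
      obtain ⟨b', rfl, hb⟩ | ⟨s, rfl, hs⟩ := h1.lam_inv
      · exact ⟨_, hb.inst h2, .single (.redex _ _)⟩
      -- Trivial overlap: `(λ x. s x) a` becomes `s a` both by `β` and by `η`.
      · refine ⟨_, ?_, .refl⟩
        rw [app_var_inst]
        exact .app hs h2
    | appL _ h =>
      obtain ⟨w, h, h'⟩ := iht h
      exact ⟨_, .app h h2, h'.appL _⟩
    | appR _ h =>
      obtain ⟨w, h, h'⟩ := ihu h
      exact ⟨_, .app h1 h, h'.appR _⟩
  | lam _ ih =>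
    cases hu with
    | lam hu =>
      obtain ⟨w, h, h'⟩ := ih hu
      exact ⟨_, .lam h, h'.lam⟩
  | eta h1 ih =>
    rename_i s s'
    cases hu with
    | lam hu =>
      generalize hx : s.rename Fin.succ = x at hu
      cases hu with
      | redex b a =>
        cases s <;> simp at hx
        rename_i c
        subst hx
        refine ⟨s', ?_, .refl⟩
        rw [rename_upr_succ_inst_var]
        exact h1
      | appL _ h =>
        subst hx
        obtain ⟨y, rfl, hy⟩ := h.of_rename
        obtain ⟨w, h, h'⟩ := ih hy
        exact ⟨w, .eta h, h'⟩
      | appR _ h => nomatch h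

lemma BetaRed.commute_peta {k : ℕ} {t u v : Tm k} (hv : PEta t v) (hu : BetaRed t u) :
    ∃ w, PEta u w ∧ BetaRed v w := by
  induction hu with
  | refl => exact ⟨v, hv, .refl⟩
  | tail _ h ih =>
    obtain ⟨w, h1, h2⟩ := ih
    obtain ⟨x, h3, h4⟩ := h.commute_peta h1
    exact ⟨x, h3, h2.trans h4⟩

/-- Hindley–Rosen: with many-step `β` and parallel `η` as the single steps, every local divergence
closes with one step on each side. -/
theorem Red.confluent {k : ℕ} {t u v : Tm k} (hu : Red t u) (hv : Red t v) :
    ∃ w, Red u w ∧ Red v w := by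
  have key : ∀ a b c : Tm k, (BetaRed a b ∨ PEta a b) → (BetaRed a c ∨ PEta a c) →
      ∃ d, ReflGen (fun a b => BetaRed a b ∨ PEta a b) b d ∧
        ReflTransGen (fun a b => BetaRed a b ∨ PEta a b) c d := by
    rintro a b c (h | h) (h' | h')
    · obtain ⟨w, h, h'⟩ := h.confluent h'
      exact ⟨w, .single (.inl h), .single (.inl h')⟩
    · obtain ⟨w, h, h'⟩ := h.commute_peta h'
      exact ⟨w, .single (.inr h), .single (.inl h')⟩
    · obtain ⟨w, h, h'⟩ := h'.commute_peta h
      exact ⟨w, .single (.inl h'), .single (.inr h)⟩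
    · obtain ⟨w, h, h'⟩ := h.diamond h'
      exact ⟨w, .single (.inr h), .single (.inr h')⟩
  have hto : ∀ {a b : Tm k}, Red a b → ReflTransGen (fun a b => BetaRed a b ∨ PEta a b) a b :=
    fun h => ReflTransGen.mono (r := BetaEta)
      (fun _ _ (h : BetaEta _ _) => h.imp ReflTransGen.single Eta.peta) _ _ h
  have hfrom : ∀ {a b : Tm k}, ReflTransGen (fun a b => BetaRed a b ∨ PEta a b) a b → Red a b := by
    intro a b h
    induction h with
    | refl => exact .refl
    | tail _ h ih => exact ih.trans (h.elim BetaRed.red fun h => h.etaRed.red)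
  obtain ⟨w, h, h'⟩ := church_rosser key (hto hu) (hto hv)
  exact ⟨w, hfrom h, hfrom h'⟩

/-! ### Postponement of `η` -/

/-- The term `t` is an abstraction wrapped in `η`-expansions; on application to `a` each wrapper is
removed by one `β`-step. -/
lemma PEta.postpone_redex {k : ℕ} {t : Tm k} {b' : Tm (k + 1)} (h : PEta t (Tm.lam b'))
    {a a' : Tm k} (ha : PEta a a') : ∃ w, BetaRed (Tm.app t a) w ∧ PEta w (b'.inst a') := by
  generalize hx : Tm.lam b' = x at h
  induction h with
  | var i => nomatch hx
  | app => nomatch hx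
  | lam h =>
    cases hx
    exact ⟨_, .single (.redex _ _), h.inst ha⟩
  | eta h ih =>
    obtain ⟨w, h, h'⟩ := ih ha hx
    refine ⟨w, .head (.redex _ _) ?_, h'⟩
    rwa [app_var_inst]

lemma PEta.postpone {k : ℕ} {t u v : Tm k} (h : PEta t u) (hv : Beta u v) :
    ∃ w, BetaRed t w ∧ PEta w v := by
  induction h with
  | var i => nomatch hv
  | app h1 h2 iht ihu =>
    cases hv with
    | redex b a => exact h1.postpone_redex h2
    | appL _ h =>
      obtain ⟨w, h, h'⟩ := iht h
      exact ⟨_, h.appL _, .app h' h2⟩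
    | appR _ h =>
      obtain ⟨w, h, h'⟩ := ihu h
      exact ⟨_, h.appR _, .app h1 h'⟩
  | lam _ ih =>
    cases hv with
    | lam hv =>
      obtain ⟨w, h, h'⟩ := ih hv
      exact ⟨_, h.lam, .lam h'⟩
  | eta _ ih =>
    obtain ⟨w, h, h'⟩ := ih hv
    refine ⟨_, ?_, .eta h'⟩
    exact ((h.rename Fin.succ).appL _).lam

lemma PEta.postpone_betaRed {k : ℕ} {t u v : Tm k} (h : PEta t u) (hv : BetaRed u v) :
    ∃ w, BetaRed t w ∧ PEta w v := by
  induction hv with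
  | refl => exact ⟨t, .refl, h⟩
  | tail _ hv ih =>
    obtain ⟨w, h1, h2⟩ := ih
    obtain ⟨x, h3, h4⟩ := h2.postpone hv
    exact ⟨x, h1.trans h3, h4⟩

/-- For Plotkin's term this allows the kinds to be tracked along `β` alone, leaving for `η` only the
preservation of free variables. -/
theorem Red.exists_betaRed_etaRed {k : ℕ} {t u : Tm k} (h : Red t u) :
    ∃ w, BetaRed t w ∧ ReflTransGen PEta w u := by
  induction h using ReflTransGen.head_induction_on with
  | refl => exact ⟨u, .refl, .refl⟩
  | head h _ ih =>
    obtain ⟨w, h1, h2⟩ := ih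
    obtain h | h := h
    · exact ⟨w, .head h h1, h2⟩
    · obtain ⟨x, h3, h4⟩ := h.peta.postpone_betaRed h1
      exact ⟨x, h3, .head h4 h2⟩

/-! ### Zero-terms -/

lemma BetaRed.lam_inv {k : ℕ} {b : Tm (k + 1)} {v : Tm k} (h : BetaRed (Tm.lam b) v) :
    ∃ b', v = Tm.lam b' ∧ BetaRed b b' := by
  induction h with
  | refl => exact ⟨b, rfl, .refl⟩
  | tail _ h ih =>
    obtain ⟨b', rfl, hb⟩ := ih
    cases h with
    | lam h => exact ⟨_, rfl, hb.tail h⟩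

lemma IsZeroTerm.of_betaRed {M M' : Tm 0} (hM : IsZeroTerm M) (h : BetaRed M M') :
    IsZeroTerm M' := fun b hb => hM b (h.trans hb)

lemma IsZeroTerm.of_betaRed_symm {M M' : Tm 0} (hM : IsZeroTerm M') (h : BetaRed M M') :
    IsZeroTerm M := fun b hb => by
  obtain ⟨w, h1, h2⟩ := h.confluent hb
  obtain ⟨b', rfl, -⟩ := h2.lam_inv
  exact hM b' h1

lemma PEta.eq_lam {k : ℕ} {t : Tm k} {b : Tm (k + 1)} (h : PEta t (Tm.lam b)) :
    ∃ b', t = Tm.lam b' := by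
  cases h with
  | lam h => exact ⟨_, rfl⟩
  | eta h => exact ⟨_, rfl⟩

/-- A `β`-reduction to an abstraction can be moved before the `η`-step, and only abstractions
`η`-reduce to abstractions. -/
lemma IsZeroTerm.of_peta {M M' : Tm 0} (hM : IsZeroTerm M) (h : PEta M M') : IsZeroTerm M' :=
  fun b hb => by
    obtain ⟨w, h1, h2⟩ := h.postpone_betaRed hb
    obtain ⟨b', rfl⟩ := h2.eq_lam
    exact hM b' h1

lemma IsZeroTerm.of_red {M M' : Tm 0} (hM : IsZeroTerm M) (h : Red M M') : IsZeroTerm M' := by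
  induction h with
  | refl => exact hM
  | tail _ h ih => exact h.elim (fun h => ih.of_betaRed (.single h)) fun h => ih.of_peta h.peta

lemma IsZeroTerm.ne_lam {M : Tm 0} (hM : IsZeroTerm M) (b : Tm 1) : M ≠ lam b := by
  rintro rfl
  exact hM b .refl

/-- If `t` expands a zero-term by `η`, then `t a` is a zero-term. -/
lemma IsZeroTerm.app_of_peta {t z : Tm 0} (hz : IsZeroTerm z) (h : PEta t z) (a : Tm 0) :
    IsZeroTerm (app t a) := by
  intro b hb
  -- Invariant: each reduct is an application whose function part `η`-expands a zero-term. If that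
  -- part is an abstraction, it is an `η`-redex `λ x. s x`, and contracting the application only
  -- removes this expansion.
  suffices H : ∀ v, BetaRed (app t a) v →
      ∃ t' a' z', v = app t' a' ∧ PEta t' z' ∧ IsZeroTerm z' by
    obtain ⟨_, _, _, h, -⟩ := H _ hb
    cases h
  intro v hv
  induction hv with
  | refl => exact ⟨t, a, z, rfl, h, hz⟩
  | tail _ hs ih =>
    obtain ⟨t', a', z', rfl, h', hz'⟩ := ih
    cases hs with
    | redex c _ =>
      obtain ⟨c', rfl, -⟩ | ⟨s, rfl, hs⟩ := h'.lam_inv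
      · exact absurd rfl (hz'.ne_lam c')
      · rw [app_var_inst]
        exact ⟨_, _, _, rfl, hs, hz'⟩
    | appL _ hs =>
      obtain ⟨w, h1, h2⟩ := hs.commute_peta h'
      exact ⟨_, _, _, rfl, h1, hz'.of_betaRed h2⟩
    | appR _ hs => exact ⟨_, _, _, rfl, h', hz'⟩

lemma IsZeroTerm.app {t : Tm 0} (ht : IsZeroTerm t) (a : Tm 0) : IsZeroTerm (app t a) :=
  ht.app_of_peta (.refl t) a

lemma IsZeroTerm.apps {t : Tm 0} (ht : IsZeroTerm t) (l : List (Tm 0)) :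
    IsZeroTerm (t.apps l) := by
  induction l generalizing t with
  | nil => exact ht
  | cons a l ih => exact ih (ht.app a)

/-! ### Terms that become zero-terms under application -/

lemma apps_append {k : ℕ} (t : Tm k) (l l' : List (Tm k)) :
    t.apps (l ++ l') = (t.apps l).apps l' := List.foldl_append

lemma PEta.apps {t t' : Tm 0} (h : PEta t t') (l : List (Tm 0)) :
    PEta (t.apps l) (t'.apps l) := by
  induction l generalizing t t' with
  | nil => exact h
  | cons a l ih => exact ih (.app h (.refl a))

/-- `U` becomes a zero-term when it is applied to suitable closed terms. -/
def ZeroAble (U : Tm 0) : Prop := ∃ l, IsZeroTerm (U.apps l)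

/-- An `η`-expansion of a zero-term may be an abstraction, but it is a zero-term again after one
arbitrary further argument; hence the extra argument for `η`. -/
lemma ZeroAble.of_red_symm {U V : Tm 0} (hV : ZeroAble V) (h : Red U V) : ZeroAble U := by
  induction h using ReflTransGen.head_induction_on with
  | refl => exact hV
  | head h _ ih =>
    obtain ⟨l, hl⟩ := ih
    obtain h | h := h
    · exact ⟨l, hl.of_betaRed_symm (.single (h.apps l))⟩
    · refine ⟨l ++ [lam (var 0)], ?_⟩
      rw [apps_append]
      exact hl.app_of_peta (h.peta.apps l) _

/-- The term `Ω`. -/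
def bigOmega : Tm 0 := app (lam (app (var 0) (var 0))) (lam (app (var 0) (var 0)))

lemma isZeroTerm_bigOmega : IsZeroTerm bigOmega := by
  intro b hb
  suffices H : ∀ v, BetaRed bigOmega v → v = bigOmega by cases H _ hb
  intro v hv
  induction hv with
  | refl => rfl
  | tail _ h ih =>
    subst ih
    cases h with
    | redex => rfl
    | appL _ h => cases h with | lam h => cases h with
      | appL _ h => cases h
      | appR _ h => cases h
    | appR _ h => cases h with | lam h => cases h with
      | appL _ h => cases h
      | appR _ h => cases h

/-- A `β`-normal term that is not an abstraction has a head variable, where `Ω` blocks the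
evaluation. Leading abstractions are removed by feeding them further copies of `Ω`. -/
lemma zeroAble_subst_bigOmega {k : ℕ} (t : Tm k) (ht : ∀ u, ¬ Beta t u) :
    ((∀ b, t ≠ lam b) → IsZeroTerm (t.subst fun _ => bigOmega)) ∧
      ZeroAble (t.subst fun _ => bigOmega) := by
  induction t with
  | var i => exact ⟨fun _ => isZeroTerm_bigOmega, [], isZeroTerm_bigOmega⟩
  | app t u iht ihu =>
    have := (iht fun v hv => ht _ (hv.appL u)).1 fun b hb => by subst hb; exact ht _ (.redex b u)
    exact ⟨fun _ => this.app _, [], this.app _⟩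
  | lam t ih =>
    refine ⟨fun h => absurd rfl (h t), ?_⟩
    obtain ⟨l, hl⟩ := (ih fun v hv => ht _ hv.lam).2
    refine ⟨bigOmega :: l, hl.of_betaRed_symm (.single (Beta.apps ?_ l))⟩
    have := Beta.redex (t.subst (ups fun _ => bigOmega)) bigOmega
    rw [subst_ups_inst] at this
    refine (congrArg (Beta _) (congrArg t.subst ?_)).mp this
    funext i
    refine Fin.cases rfl (fun i => rfl) i

lemma IsNormal.eq_of_red {k : ℕ} {t u : Tm k} (ht : IsNormal t) (h : Red t u) : u = t := by
  induction h with
  | refl => rfl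
  | tail _ h ih => subst ih; exact absurd h (ht _)

lemma IsNormal.zeroAble {t : Tm 0} (ht : IsNormal t) : ZeroAble t := by
  have := (zeroAble_subst_bigOmega t fun u hu => ht u (.inl hu)).2
  rwa [show (fun _ : Fin 0 => bigOmega) = var from funext fun i => i.elim0, subst_id] at this

/-- The head of a closed application cannot be a variable, so there is a head redex. In particular
zero-terms are never normal. -/
lemma exists_beta_of_ne_lam (t : Tm 0) (ht : ∀ b, t ≠ lam b) : ∃ u, Beta t u := by
  generalize hk : 0 = k at t
  induction t with
  | var i => subst hk; exact i.elim0
  | lam t => subst hk; exact absurd rfl (ht t)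
  | app t u iht ihu =>
    subst hk
    by_cases h : ∃ b, t = lam b
    · obtain ⟨b, rfl⟩ := h
      exact ⟨_, .redex b u⟩
    · obtain ⟨v, hv⟩ := iht rfl fun b hb => h ⟨b, hb⟩
      exact ⟨_, hv.appL u⟩

lemma IsSupercofinal.mem_of_isNormal {X : Set (Tm 0)} (hX : IsSupercofinal X) {t : Tm 0}
    (ht : IsNormal t) : t ∈ X := by
  refine hX.2 t ?_
  rintro ⟨Z, hZ, h⟩
  obtain rfl := ht.eq_of_red h
  obtain ⟨u, hu⟩ := exists_beta_of_ne_lam Z hZ.ne_lam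
  exact ht u (.inl hu)

lemma IsSupercofinal.mem_of_not_zeroAble {X : Set (Tm 0)} (hX : IsSupercofinal X) {t : Tm 0}
    (ht : ¬ ZeroAble t) : t ∈ X :=
  hX.2 t fun ⟨_, hZ, h⟩ => ht (.of_red_symm ⟨[], hZ⟩ h)

/-- Finitely many closed terms can simultaneously be applied to closed terms such that each of the
results is a zero-term or can no longer be turned into one by further arguments. -/
lemma exists_apps_isZeroTerm_or (l : List (Tm 0)) :
    ∃ R : List (Tm 0), ∀ U ∈ l, IsZeroTerm (U.apps R) ∨ ¬ ZeroAble (U.apps R) := by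
  induction l with
  | nil => exact ⟨[], fun U h => nomatch h⟩
  | cons V l ih =>
    obtain ⟨R, hR⟩ := ih
    -- Both alternatives persist under further arguments, so the terms can be treated one after the
    -- other.
    have hpers : ∀ S : List (Tm 0), ∀ U ∈ l,
        IsZeroTerm (U.apps (R ++ S)) ∨ ¬ ZeroAble (U.apps (R ++ S)) := fun S U hU => by
      rw [apps_append]
      refine (hR U hU).imp (fun h => h.apps S) fun h ⟨S', h'⟩ => h ⟨S ++ S', ?_⟩
      rwa [apps_append]
    by_cases h : ZeroAble (V.apps R)
    · obtain ⟨S, hS⟩ := h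
      refine ⟨R ++ S, fun U hU => ?_⟩
      obtain rfl | hU := List.mem_cons.1 hU
      · rw [apps_append]; exact .inl hS
      · exact hpers S U hU
    · refine ⟨R, fun U hU => ?_⟩
      obtain rfl | hU := List.mem_cons.1 hU
      · exact .inr h
      · exact hR U hU

end LamOmega

namespace LamOmega

open Ordinal

/-! ### Hessenberg sums -/

lemma cnf_eval_mono {b : Ordinal.{0}} {g : Ordinal.{0} →₀ Ordinal.{0}} :
    ∀ {f : Ordinal.{0} →₀ Ordinal.{0}}, (∀ e, f e ≤ g e) → CNF.eval b f ≤ CNF.eval b g := by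
  induction g using Finsupp.induction_on_max with
  | zero =>
    intro f h
    have : f = 0 := Finsupp.ext fun e => nonpos_iff_eq_zero.1 (h e)
    rw [this]
  | single_add e y g hg hy ih =>
    intro f h
    have hge : g e = 0 := Finsupp.notMem_support_iff.1 fun h => (hg e h).false
    have hlt : ∀ e' ∈ (f.erase e).support, e' < e := by
      intro e' he'
      rw [Finsupp.support_erase, Finset.mem_erase] at he'
      refine hg e' (Finsupp.mem_support_iff.2 fun h0 => ?_)
      have := h e'
      rw [Finsupp.add_apply, Finsupp.single_eq_of_ne he'.1, h0, zero_add,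
        nonpos_iff_eq_zero] at this
      exact Finsupp.mem_support_iff.1 he'.2 this
    rw [← Finsupp.single_add_erase e f, CNF.eval_single_add' _ hlt, CNF.eval_single_add' _ hg]
    refine add_le_add ?_ (ih fun e' => ?_)
    · have := h e
      rw [Finsupp.add_apply, Finsupp.single_eq_same, hge, add_zero] at this
      gcongr
    · by_cases he : e' = e
      · subst he; simp
      · have := h e'
        rwa [Finsupp.add_apply, Finsupp.single_eq_of_ne he, zero_add,
          ← Finsupp.erase_ne he (f := f)] at this

lemma cnf_coeff_lt_omega0 (a e : Ordinal.{0}) : CNF.coeff ω a e < ω := by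
  by_cases h : e ∈ (CNF ω a).map Prod.fst
  · obtain ⟨⟨e', c⟩, hc, rfl⟩ := List.mem_map.1 h
    rw [CNF.coeff_of_mem_CNF hc]
    exact CNF.snd_lt one_lt_omega0 hc
  · rw [CNF.coeff_of_notMem_CNF h]
    exact omega0_pos

lemma cnf_coeff_hadd (a b : Ordinal.{0}) :
    CNF.coeff ω (hadd a b) = CNF.coeff ω a + CNF.coeff ω b :=
  CNF.coeff_eval one_lt_omega0 fun e =>
    isPrincipal_add_omega0 (cnf_coeff_lt_omega0 a e) (cnf_coeff_lt_omega0 b e)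

/-- The coefficients of `b` are dominated by those of the sum. Equality would force all coefficients
of `a` to vanish, since coefficients to the base `ω` are finite and cancel. -/
lemma lt_hadd {a : Ordinal.{0}} (ha : a ≠ 0) (b : Ordinal.{0}) : b < hadd a b := by
  refine lt_of_le_of_ne ?_ fun h => ha ?_
  · conv_lhs => rw [← CNF.eval_coeff ω b]
    exact cnf_eval_mono fun e => le_add_self
  · apply CNF.coeff_injective ω
    ext e
    have := DFunLike.congr_fun (cnf_coeff_hadd a b) e
    rw [← h, Finsupp.add_apply] at this
    obtain ⟨m, hm⟩ := lt_omega0.1 (cnf_coeff_lt_omega0 a e)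
    obtain ⟨n, hn⟩ := lt_omega0.1 (cnf_coeff_lt_omega0 b e)
    rw [hm, hn] at this
    have : n = m + n := by exact_mod_cast this
    rw [hm, CNF.coeff_zero_apply]
    exact_mod_cast (by omega : m = 0)

lemma cnf_coeff_natCast (n : ℕ) :
    CNF.coeff ω (n : Ordinal.{0}) = Finsupp.single 0 (n : Ordinal) := by
  obtain rfl | hn := eq_or_ne n 0
  · simp
  · have := CNF.coeff_opow_mul_add (b := ω) (e := 0) (x := (n : Ordinal.{0})) (y := 0)
      one_lt_omega0 (by exact_mod_cast hn) (natCast_lt_omega0 n) (by simp)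
    simpa using this

lemma hadd_natCast (m n : ℕ) : hadd m n = (m + n : ℕ) := by
  rw [hadd, cnf_coeff_natCast, cnf_coeff_natCast, ← Finsupp.single_add, CNF.eval_single]
  simp

lemma hsum_ones {α : Type*} (l : List α) : hsum (l.map fun _ => 1) = l.length := by
  induction l with
  | nil => simp [hsum]
  | cons a l ih =>
    have := hadd_natCast 1 l.length
    rw [List.map_cons, hsum, List.foldr_cons, ← hsum, ih]
    rw [Nat.cast_one] at this
    rw [this, List.length_cons, add_comm]

lemma length_le_hsum {α : Type*} (l : List α) {f : α → Ordinal.{0}} (hf : ∀ a, f a ≠ 0) :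
    (l.length : Ordinal.{0}) ≤ hsum (l.map f) := by
  induction l with
  | nil => simp
  | cons a l ih =>
    rw [List.map_cons, hsum, List.foldr_cons, ← hsum, List.length_cons, Nat.cast_succ,
      Order.add_one_le_iff]
    exact ih.trans_lt (lt_hadd (hf a) _)

/-- Every proof has nonzero ordinal, and `n` nonzero ordinals have Hessenberg sum at least `n`; so
auxiliary leaves with premises of ordinal `1` cannot raise the rank. -/
lemma omegaOrd_one_le {f : Tm 0 → Ordinal.{0}} (hf : ∀ R, f R ≠ 0) :
    omegaOrd (fun _ => 1) ≤ omegaOrd f := by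
  refine opow_le_opow_right omega0_pos ?_
  refine Ordinal.iSup_le fun l => ?_
  rw [hsum_ones]
  exact (length_le_hsum l.1 hf).trans
    (Ordinal.le_iSup (fun l : {l : List (Tm 0) // l.Nodup} => hsum (l.1.map f)) l)

lemma OmegaProof.ord_ne_zero {A B : Tm 0} (T : OmegaProof A B) : T.ord ≠ 0 := by
  cases T with
  | omega prem => exact (opow_pos _ omega0_pos).ne'
  | endpiece =>
    rw [OmegaProof.ord]
    exact (zero_le.trans_lt (lt_hadd one_ne_zero _)).ne'

end LamOmega

namespace LamOmega

open Tm Relation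

/-! ### Convertibility -/

/-- `βη`-convertibility. -/
def Conv {k : ℕ} (a b : Tm k) : Prop := ∃ w, Red a w ∧ Red b w

lemma Conv.refl {k : ℕ} (a : Tm k) : Conv a a := ⟨a, .refl, .refl⟩

lemma Conv.symm {k : ℕ} {a b : Tm k} (h : Conv a b) : Conv b a :=
  let ⟨w, h1, h2⟩ := h; ⟨w, h2, h1⟩

lemma Conv.trans {k : ℕ} {a b c : Tm k} (h : Conv a b) (h' : Conv b c) : Conv a c := by
  obtain ⟨w, h1, h2⟩ := h
  obtain ⟨x, h3, h4⟩ := h'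
  obtain ⟨y, h5, h6⟩ := h2.confluent h3
  exact ⟨y, ReflTransGen.trans h1 h5, ReflTransGen.trans h4 h6⟩

lemma Red.conv {k : ℕ} {a b : Tm k} (h : Red a b) : Conv a b := ⟨b, h, .refl⟩

lemma Red.appR {k : ℕ} (t : Tm k) {u u' : Tm k} (h : Red u u') : Red (app t u) (app t u') :=
  ReflTransGen.lift (p := BetaEta) (fun u => Tm.app t u)
    (fun _ _ (h : BetaEta _ _) => h.imp (Beta.appR t) (Eta.appR t)) _ _ h

lemma Conv.app {k : ℕ} {a b c d : Tm k} (h : Conv a b) (h' : Conv c d) : Conv (app a c) (app b d) := by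
  obtain ⟨w, h1, h2⟩ := h
  obtain ⟨x, h3, h4⟩ := h'
  exact ⟨Tm.app w x, ReflTransGen.trans (h1.appL _) (h3.appR _),
    ReflTransGen.trans (h2.appL _) (h4.appR _)⟩

lemma Conv.appL {k : ℕ} {a b : Tm k} (h : Conv a b) (c : Tm k) : Conv (Tm.app a c) (Tm.app b c) :=
  h.app (.refl c)

lemma Conv.lam {k : ℕ} {a b : Tm (k + 1)} (h : Conv a b) : Conv (Tm.lam a) (Tm.lam b) := by
  obtain ⟨w, h1, h2⟩ := h
  have key : ∀ {a : Tm (k + 1)}, Red a w → Red (Tm.lam a) (Tm.lam w) := fun h =>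
    ReflTransGen.lift (p := BetaEta) Tm.lam
      (fun _ _ (h : BetaEta _ _) => h.imp Beta.lam Eta.lam) _ _ h
  exact ⟨_, key h1, key h2⟩

lemma Beta.conv {k : ℕ} {a b : Tm k} (h : Beta a b) : Conv a b := ⟨b, .single (.inl h), .refl⟩

/-! ### Components of canonical endpieces -/

/-- `λ y. B y`. -/
def etaExp (B : Tm 0) : Tm 0 := lam (app (B.rename Fin.succ) (var 0))

/-- The right facing arrow of the canonical component given by `λ x. λ y. E y` can end in `H` if
the value of `E` is `B`. -/
def Lands (B H : Tm 0) : Prop :=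
  ∃ J, NormalOrSelf (etaExp B) J ∧ Red (etaExp B) J ∧ Red J H

lemma etaExp_eta (B : Tm 0) : Eta (etaExp B) B := .redex B

lemma etaExp_red (B : Tm 0) : Red (etaExp B) B := .single (.inr (.redex B))

/-- `λ x. λ y. E y`. -/
def component (E : Tm 1) : Tm 0 := lam (lam (app (E.rename Fin.succ) (var 0)))

lemma inst_component (E : Tm 1) (M : Tm 0) :
    (lam (app (E.rename Fin.succ) (var 0))).inst M = etaExp (E.inst M) := by
  rw [inst_eq, subst_lam, subst_app, rename_succ_subst_ups]
  rfl

lemma component_red (E : Tm 1) (M : Tm 0) : Red (app (component E) M) (etaExp (E.inst M)) := by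
  refine .single (.inl ?_)
  rw [← inst_component]
  exact .redex _ _

lemma Lands.red {B H : Tm 0} (h : Lands B H) : Red (etaExp B) H :=
  let ⟨_, _, h1, h2⟩ := h; ReflTransGen.trans h1 h2

lemma weaken_zero {k : ℕ} (t : Tm k) : t.weaken 0 = t :=
  rename_id t

/-- The case `m = n = 0` with `Y = E y`: the non-head part is empty, a single `η`-step leads to
`E[M]`, and `J₀` is all that the right arrow has to visit. -/
lemma canonicalComponent_component {E : Tm 1} {M N H : Tm 0} (h : Lands (E.inst N) H) :
    CanonicalComponent (component E) M N (E.inst M) H := by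
  obtain ⟨J, h1, h2, h3⟩ := h
  have hc := inst_component E N
  refine ⟨0, app (E.rename Fin.succ) (var 0), [], Fin.elim0, ?_, ⟨etaExp (E.inst M), ?_, ?_⟩,
    ?_, ?_, J, [], ?_, .nil, ?_, h3⟩
  · exact congrArg lam (weaken_zero (lam (app (E.rename Fin.succ) (var 0)))).symm
  · have := inst_component E M
    refine (congrArg (ReflTransGen NonHead · (etaExp (E.inst M))) ?_).mpr .refl
    exact (congrArg (fun t : Tm 1 => t.inst M) (weaken_zero _)).trans this
  · exact .single (etaExp_eta _)
  · refine (congrArg₂ (x' := etaExp (E.inst N)) (y' := etaExp (E.inst N)) Red ?_ ?_).mpr .refl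
    · exact (congrArg (fun t : Tm 1 => t.inst N) (weaken_zero _)).trans hc
    · exact (weaken_zero _).trans hc
  · refine (congrArg₂ (x' := etaExp (E.inst N)) (y' := etaExp (E.inst N)) EtaRed ?_ ?_).mpr .refl
    · exact (weaken_zero _).trans hc
    · exact hc
  · exact (congrArg (NormalOrSelf · J) hc).mpr h1
  · exact (congrArg (Red · J) hc).mpr h2

/-- If `λ y. B y` has a normal form, that form itself lies in `X`; otherwise `J₀` is `λ y. B y`,
from which any reduct of `B` in `X` can be reached. -/
lemma exists_lands {X : Set (Tm 0)} (hX : IsSupercofinal X) (B : Tm 0) :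
    ∃ H ∈ X, Lands B H ∧ Red B H := by
  by_cases h : ∃ J, Red (etaExp B) J ∧ IsNormal J
  · obtain ⟨J, hJ, hn⟩ := h
    obtain ⟨w, h1, h2⟩ := Red.confluent hJ (etaExp_red B)
    obtain rfl := hn.eq_of_red h1
    exact ⟨w, hX.mem_of_isNormal hn, ⟨w, .inl ⟨hJ, hn⟩, hJ, .refl⟩, h2⟩
  · obtain ⟨H, hH, hr⟩ := hX.1 B
    exact ⟨H, hH, ⟨_, .inr ⟨h, rfl⟩, .refl, .trans (etaExp_red B) hr⟩, hr⟩

lemma lands_self {B : Tm 0} (hB : ¬ ∃ J, Red B J ∧ IsNormal J) : Lands B B := by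
  refine ⟨_, .inr ⟨?_, rfl⟩, .refl, etaExp_red B⟩
  rintro ⟨J, hJ, hn⟩
  obtain ⟨w, h1, h2⟩ := Red.confluent hJ (etaExp_red B)
  obtain rfl := hn.eq_of_red h1
  exact hB ⟨_, h2, hn⟩

/-! ### Canonical endpieces as paths -/

/-- `Path X H K l`: the terms `H` and `K` of `X` are the first and the last term `Hᵢ` of the
components of a canonical endpiece the leaves of which have the ordinals `l`. -/
inductive Path (X : Set (Tm 0)) : Tm 0 → Tm 0 → List Ordinal.{0} → Prop
  | nil {H : Tm 0} : H ∈ X → Path X H H []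
  | cons {H H' K G M N : Tm 0} {l : List Ordinal.{0}}
      (leaf : ∀ R : Tm 0, OmegaProof (app M R) (app N R)) :
      H ∈ X → CanonicalComponent G M N H H' → Red (app G M) H → Red (app G N) H' →
      (∀ R, (leaf R).IsCanonical X) → Path X H' K l →
      Path X H K ((OmegaProof.omega leaf).ord :: l)

lemma Path.exists_endpiece {X : Set (Tm 0)} {H K : Tm 0} {l : List Ordinal.{0}}
    (h : Path X H K l) :
    ∃ (t : ℕ) (J : Fin (t + 1) → Tm 0) (G M N : Fin t → Tm 0)
      (leaf : ∀ (i : Fin t) (R : Tm 0), OmegaProof (app (M i) R) (app (N i) R)),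
      J 0 = H ∧ J (Fin.last t) = K ∧
      (∀ i : Fin t, Red (app (G i) (M i)) (J i.castSucc)) ∧
      (∀ i : Fin t, Red (app (G i) (N i)) (J i.succ)) ∧
      (∀ i, J i ∈ X) ∧
      (∀ i : Fin t, CanonicalComponent (G i) (M i) (N i) (J i.castSucc) (J i.succ)) ∧
      (∀ (i : Fin t) (R : Tm 0), (leaf i R).IsCanonical X) ∧
      List.ofFn (fun i => (OmegaProof.omega (leaf i)).ord) = l := by
  induction h with
  | @nil H hH =>
    exact ⟨0, fun _ => H, Fin.elim0, Fin.elim0, Fin.elim0, fun i => i.elim0, rfl, rfl,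
      fun i => i.elim0, fun i => i.elim0, fun _ => hH, fun i => i.elim0, fun i => i.elim0, rfl⟩
  | @cons H H' K G M N l lf hH hc hl hr hlf _ ih =>
    obtain ⟨t, J, Gs, Ms, Ns, leaf, h0, ht, h1, h2, h3, h4, h5, h6⟩ := ih
    subst h0 ht h6
    refine ⟨t + 1, Fin.cons H J, Fin.cons G Gs, Fin.cons M Ms, Fin.cons N Ns,
      Fin.cases lf leaf, rfl, rfl, ?_, ?_, ?_, ?_, ?_, ?_⟩
    · exact Fin.cases hl h1
    · exact Fin.cases hr h2
    · exact Fin.cases hH h3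
    · exact Fin.cases hc h4
    · exact Fin.cases hlf h5
    · rw [List.ofFn_succ]; rfl

lemma rank_endpiece_le {t : ℕ} {M N : Fin t → Tm 0}
    (leaf : ∀ (i : Fin t) (R : Tm 0), OmegaProof (app (M i) R) (app (N i) R)) (i : Fin t) :
    (OmegaProof.omega (leaf i)).ord ≤ ⨆ i : Fin t, (OmegaProof.omega (leaf i)).ord :=
  Ordinal.le_iSup (fun i : Fin t => (OmegaProof.omega (leaf i)).ord) i

/-- A path between reducts of `A` and `B` yields a canonical proof of `A =_ω B`. -/
lemma Path.exists_proof {X : Set (Tm 0)} {H K A B : Tm 0} {l : List Ordinal.{0}}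
    (h : Path X H K l) (hA : Red A H) (hB : Red B K) {r : Ordinal.{0}} (hle : ∀ o ∈ l, o ≤ r)
    (hge : ∀ s, (∀ o ∈ l, o ≤ s) → r ≤ s) :
    ∃ T : OmegaProof A B, T.IsCanonical X ∧ T.EndsInEndpiece ∧ T.rank = r := by
  obtain ⟨t, J, G, M, N, leaf, rfl, rfl, h1, h2, h3, h4, h5, rfl⟩ := h.exists_endpiece
  refine ⟨.endpiece t J G M N leaf hA h1 h2 hB, ⟨h3, h4, h5⟩, trivial, ?_⟩
  refine le_antisymm (Ordinal.iSup_le fun i => hle _ (List.mem_ofFn.2 ⟨i, rfl⟩)) ?_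
  refine hge _ fun o ho => ?_
  obtain ⟨i, rfl⟩ := List.mem_ofFn.1 ho
  exact rank_endpiece_le leaf i

/-- The common value of the ordinals of the leaves that only need conversions. -/
noncomputable def convOrd : Ordinal.{0} := omegaOrd fun _ => 1

lemma convOrd_le {M N : Tm 0} (leaf : ∀ R : Tm 0, OmegaProof (app M R) (app N R)) :
    convOrd ≤ (OmegaProof.omega leaf).ord :=
  omegaOrd_one_le fun R => (leaf R).ord_ne_zero

/-- Two closed terms that are convertible after application to every closed term are equated by a
canonical leaf of the least possible ordinal. -/
lemma exists_leaf_of_conv {X : Set (Tm 0)} (hX : IsSupercofinal X) {U V : Tm 0}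
    (h : ∀ R, Conv (app U R) (app V R)) :
    ∃ leaf : ∀ R : Tm 0, OmegaProof (app U R) (app V R),
      (∀ R, (leaf R).IsCanonical X) ∧ (OmegaProof.omega leaf).ord = convOrd := by
  have key : ∀ R, ∃ w ∈ X, Red (app U R) w ∧ Red (app V R) w := fun R => by
    obtain ⟨w, h1, h2⟩ := h R
    obtain ⟨x, hx, hr⟩ := hX.1 w
    exact ⟨x, hx, ReflTransGen.trans h1 hr, ReflTransGen.trans h2 hr⟩
  choose w hw h1 h2 using key
  refine ⟨fun R => .endpiece 0 (fun _ => w R) Fin.elim0 Fin.elim0 Fin.elim0 (fun i => i.elim0)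
    (h1 R) (fun i => i.elim0) (fun i => i.elim0) (h2 R),
    fun R => ⟨fun _ => hw R, fun i => i.elim0, fun i => i.elim0⟩, ?_⟩
  rw [OmegaProof.ord, convOrd]
  congr 1
  funext R
  rw [OmegaProof.ord]
  have := hadd_natCast 1 0
  simpa [hsum] using this

/-- A component that replaces `U` by `V`. -/
lemma Path.cons_conv {X : Set (Tm 0)} (hX : IsSupercofinal X) {U V H K : Tm 0}
    {l : List Ordinal.{0}} (hU : U ∈ X) (h : ∀ R, Conv (app U R) (app V R)) (hl : Lands V H)
    (hp : Path X H K l) : Path X U K (convOrd :: l) := by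
  obtain ⟨leaf, h1, h2⟩ := exists_leaf_of_conv hX h
  rw [← h2]
  refine .cons (G := component (var 0)) leaf hU (canonicalComponent_component (E := var 0) hl)
    ?_ ?_ h1 hp
  · exact .trans (component_red _ _) (etaExp_red U)
  · exact .trans (component_red _ _) hl.red

/-- A component with a given leaf. -/
lemma Path.cons_component {X : Set (Tm 0)} {M N H K : Tm 0} {E : Tm 1}
    {l : List Ordinal.{0}} (leaf : ∀ R : Tm 0, OmegaProof (app M R) (app N R))
    (hlf : ∀ R, (leaf R).IsCanonical X) (hM : E.inst M ∈ X) (hl : Lands (E.inst N) H)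
    (hp : Path X H K l) : Path X (E.inst M) K ((OmegaProof.omega leaf).ord :: l) := by
  refine .cons (G := component E) leaf hM (canonicalComponent_component hl) ?_ ?_ hlf hp
  · exact .trans (component_red _ _) (etaExp_red _)
  · exact .trans (component_red _ _) hl.red

/-! ### Components without normal forms -/

lemma apps_subst {k l : ℕ} (t : Tm k) (us : List (Tm k)) (σ : Fin k → Tm l) :
    (t.apps us).subst σ = (t.subst σ).apps (us.map fun u => u.subst σ) := by
  induction us generalizing t with
  | nil => rfl
  | cons u us ih => exact ih (app t u)

/-- `G x l`, where `x` is a free variable. -/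
def openApps (G : Tm 0) (l : List (Tm 0)) : Tm 1 :=
  (app (G.rename Fin.succ) (var 0)).apps (l.map fun u => u.rename Fin.succ)

lemma inst_openApps (G : Tm 0) (l : List (Tm 0)) (c : Tm 0) :
    (openApps G l).inst c = (app G c).apps l := by
  rw [openApps, inst_eq, apps_subst, List.map_map, ← inst_eq, app_var_inst]
  congr 1
  exact (List.map_congr_left fun u _ => rename_succ_inst u c).trans (List.map_id l)

/-- `λ z. B T z`. -/
def guarded (B : Tm 0) (T : Tm 1) : Tm 0 := lam (app (app (B.rename Fin.succ) T) (var 0))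

/-- Reductions take place inside `B` or inside `T` only: a redex `B T` would need `B` to be an
abstraction, and an `η`-step at the root would need `z` to have disappeared from `T`. -/
lemma red_guarded {B : Tm 0} (hB : IsZeroTerm B) {T : Tm 1}
    (hT : ∀ T', Red T T' → ∀ s : Tm 0, T' ≠ s.rename Fin.succ) {v : Tm 0}
    (h : Red (guarded B T) v) :
    ∃ B' T', v = guarded B' T' ∧ IsZeroTerm B' := by
  suffices H : ∃ B' T', v = guarded B' T' ∧ Red B B' ∧ Red T T' by
    obtain ⟨B', T', h1, h2, -⟩ := H
    exact ⟨B', T', h1, hB.of_red h2⟩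
  induction h with
  | refl => exact ⟨B, T, rfl, .refl, .refl⟩
  | tail _ h ih =>
    obtain ⟨B', T', rfl, h1, h2⟩ := ih
    have hB' := hB.of_red h1
    rw [guarded] at h
    generalize hx : B'.rename Fin.succ = x at h
    obtain h | h := h
    · cases h with | lam h => cases h with
      | appR _ h => cases h
      | appL _ h => cases h with
        | redex b _ =>
          cases B' <;> simp at hx
          exact absurd rfl (hB'.ne_lam _)
        | appR _ h => subst hx; exact ⟨_, _, rfl, h1, h2.tail (.inl h)⟩
        | appL _ h =>
          subst hx
          obtain ⟨s, rfl, hs⟩ := h.of_rename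
          exact ⟨_, _, rfl, h1.tail (.inl hs), h2⟩
    · generalize hy : lam (Tm.app (Tm.app x T') (var 0)) = y at h
      cases h with
      | appL => cases hy
      | appR => cases hy
      | redex =>
        simp only [lam.injEq, app.injEq, and_true] at hy
        rename_i s _
        cases s <;> simp at hy
        exact absurd hy.2 (hT _ h2 _)
      | lam h =>
        cases hy
        cases h with
        | appR _ h => cases h
        | appL _ h => cases h with
          | appR _ h => subst hx; exact ⟨_, _, rfl, h1, h2.tail (.inr h)⟩
          | appL _ h =>
            subst hx
            obtain ⟨s, rfl, hs⟩ := h.peta.of_rename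
            exact ⟨_, _, rfl, ReflTransGen.trans h1 hs.etaRed.red, h2⟩

lemma IsSupercofinal.guarded_mem {X : Set (Tm 0)} (hX : IsSupercofinal X) {B : Tm 0}
    (hB : IsZeroTerm B) {T : Tm 1}
    (hT : ∀ T', Red T T' → ∀ s : Tm 0, T' ≠ s.rename Fin.succ) : guarded B T ∈ X := by
  refine hX.2 _ ?_
  rintro ⟨Z, hZ, h⟩
  obtain ⟨B', T', rfl, -⟩ := red_guarded hB hT h
  exact hZ.ne_lam _ rfl

lemma not_red_isNormal_guarded {B : Tm 0} (hB : IsZeroTerm B) {T : Tm 1}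
    (hT : ∀ T', Red T T' → ∀ s : Tm 0, T' ≠ s.rename Fin.succ) :
    ¬ ∃ J, Red (guarded B T) J ∧ IsNormal J := by
  rintro ⟨J, h, hn⟩
  obtain ⟨B', T', rfl, hB'⟩ := red_guarded hB hT h
  obtain ⟨u, hu⟩ := exists_beta_of_ne_lam B' hB'.ne_lam
  exact hn _ (.inl (.lam (.appL _ (.appL _ (hu.rename _)))))

lemma inst_guarded (E : Tm 1) (T : Tm 1) (c : Tm 0) :
    (lam (app (app (E.rename Fin.succ) (T.rename fun _ => 0)) (var 0))).inst c =
      guarded (E.inst c) T := by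
  rw [inst_eq, subst_lam, subst_app, subst_app, rename_succ_subst_ups, rename_subst]
  have : ups (scons c var) ∘ (fun _ : Fin 1 => (0 : Fin 2)) = var := by
    funext i; rw [Subsingleton.elim i 0]; rfl
  rw [this, subst_id]
  rfl

lemma guarded_app_red (B : Tm 0) (T : Tm 1) (c : Tm 0) :
    Red (app (guarded B T) c) (app (app B (T.inst c)) c) := by
  refine .single (.inl ?_)
  have := Beta.redex (app (app (B.rename Fin.succ) T) (var 0)) c
  rwa [show (app (app (B.rename Fin.succ) T) (var 0)).inst c = app (app B (T.inst c)) c from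
    congrArg (fun t => app (app t _) c) (rename_succ_inst B c)] at this

/-- If `G M l` is a zero-term or cannot be turned into one, then up to convertibility after
application to closed terms `G x l W` is given by a term the instance of which at `M` lies in `X`
and has no normal form. -/
lemma exists_open_term {X : Set (Tm 0)} (hX : IsSupercofinal X) {T : Tm 1} {W : Tm 0}
    (hT : ∀ T', Red T T' → ∀ s : Tm 0, T' ≠ s.rename Fin.succ)
    (hW : ∀ c, Conv (T.inst c) W) {G M : Tm 0} {l : List (Tm 0)}
    (h : IsZeroTerm ((app G M).apps l) ∨ ¬ ZeroAble ((app G M).apps l)) :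
    ∃ E : Tm 1, E.inst M ∈ X ∧ Lands (E.inst M) (E.inst M) ∧
      ∀ b c, Conv (app (E.inst b) c) (app ((app G b).apps (l ++ [W])) c) := by
  obtain h | h := h
  -- The variable of `T` is identified with the bound variable `z`; the variable `x` occurs only in
  -- `G x l`.
  · refine ⟨lam (app (app ((openApps G l).rename Fin.succ) (T.rename fun _ => 0)) (var 0)),
      ?_, ?_, fun b c => ?_⟩
    · rw [inst_guarded, inst_openApps]
      exact hX.guarded_mem h hT
    · rw [inst_guarded, inst_openApps]
      exact lands_self (not_red_isNormal_guarded h hT)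
    · rw [inst_guarded, inst_openApps, apps_append]
      exact (guarded_app_red _ _ _).conv.trans (((Conv.refl _).app (hW c)).appL c)
  · refine ⟨openApps G (l ++ [W]), ?_, ?_, fun b c => ?_⟩
    all_goals rw [inst_openApps]
    · refine hX.mem_of_not_zeroAble ?_
      rintro ⟨l', h'⟩
      rw [apps_append] at h'
      exact h ⟨W :: l', h'⟩
    · refine lands_self ?_
      rintro ⟨J, hJ, hn⟩
      obtain ⟨l', h'⟩ := hn.zeroAble.of_red_symm hJ
      rw [apps_append] at h'
      exact h ⟨W :: l', h'⟩
    · exact .refl _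

/-- Canonical proofs extend to further arguments with the same rank, provided that some open term
retains its variable under reduction while its closed instances are all convertible. -/
lemma exists_canonical_apps {X : Set (Tm 0)} (hX : IsSupercofinal X) {Th : Tm 1} {W : Tm 0}
    (hTh : ∀ T', Red Th T' → ∀ s : Tm 0, T' ≠ s.rename Fin.succ)
    (hW : ∀ c, Conv (Th.inst c) W) {A B : Tm 0} (T : OmegaProof A B) (hT : T.IsCanonical X)
    (hE : T.EndsInEndpiece) (P : List (Tm 0)) :
    ∃ (R : List (Tm 0)) (T₁ : OmegaProof ((A.apps P).apps R) ((B.apps P).apps R)),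
      T₁.IsCanonical X ∧ T₁.EndsInEndpiece ∧ T₁.rank = T.rank := by
  cases T with
  | omega => exact hE.elim
  | endpiece t J G M N leaf start left right finish =>
  obtain ⟨-, -, hleaf⟩ := hT
  obtain ⟨S, hS⟩ := exists_apps_isZeroTerm_or (List.ofFn fun i => (app (G i) (M i)).apps P)
  have hS' : ∀ i, IsZeroTerm ((app (G i) (M i)).apps (P ++ S)) ∨
      ¬ ZeroAble ((app (G i) (M i)).apps (P ++ S)) := fun i => by
    rw [apps_append]
    exact hS _ (List.mem_ofFn.2 ⟨i, rfl⟩)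
  choose E hE1 hE2 hE3 using fun i => exists_open_term hX hTh hW (hS' i)
  -- `S` secures the dichotomy for all components at once, and `W` is the value that Plotkin's term
  -- takes on closed arguments.
  refine ⟨S ++ [W], ?_⟩
  rw [← apps_append, ← apps_append, ← List.append_assoc]
  set Q := P ++ S ++ [W] with hQ
  obtain ⟨K, hK, hrK⟩ := hX.1 ((J 0).apps Q)
  -- Without leaves the rank is `0`, so no auxiliary leaf is allowed and the single conversion is
  -- kept.
  obtain rfl | ht := Nat.eq_zero_or_pos t
  · refine Path.exists_proof (.nil hK) (ReflTransGen.trans (start.apps Q) hrK)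
      (ReflTransGen.trans (finish.apps Q) hrK) (by simp) fun s _ => ?_
    exact Ordinal.iSup_le fun i => i.elim0
  -- The path is built from the right end. The entry point `K` has to agree with `Jᵢ Q` only after
  -- application to closed terms, which is what an auxiliary leaf can bridge.
  have main : ∀ i : Fin (t + 1), ∀ K ∈ X, (∀ c, Conv (app K c) (app ((J i).apps Q) c)) →
      ∃ H l, Path X K H l ∧ Red (B.apps Q) H ∧
        (∀ o ∈ l, o = convOrd ∨ ∃ j : Fin t, o = (OmegaProof.omega (leaf j)).ord) ∧
        ∀ j : Fin t, i ≤ j.castSucc → (OmegaProof.omega (leaf j)).ord ∈ l := by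
    intro i
    induction i using Fin.reverseInduction with
    | last =>
      intro K hK hc
      obtain ⟨H, hH, hl, hr⟩ := exists_lands hX (B.apps Q)
      refine ⟨H, _, Path.cons_conv hX hK (fun c => (hc c).trans ?_) hl (.nil hH), hr, by simp,
        fun j hj => absurd hj (not_le.2 (Fin.castSucc_lt_last j))⟩
      exact ((finish.apps Q).conv.appL c).symm
    | cast i ih =>
      intro K hK hc
      obtain ⟨H, hH, hl, hr⟩ := exists_lands hX ((E i).inst (N i))
      obtain ⟨H', l, hp, hr', h1, h2⟩ := ih H hH fun c =>
        (hr.conv.appL c).symm.trans ((hE3 i (N i) c).trans (((right i).apps Q).conv.appL c))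
      -- Two components for each old one: first from `K` to `E[Mᵢ]` by conversions under the
      -- `ω`-rule, then from `E[Mᵢ]` to a reduct of `λ y. E[Nᵢ] y` by the original leaf.
      refine ⟨H', _, Path.cons_conv hX hK (fun c => ?_) (hE2 i)
        (Path.cons_component (leaf i) (hleaf i) (hE1 i) hl hp), hr', ?_, ?_⟩
      · exact (hc c).trans (((((left i).apps Q).conv.appL c).symm).trans (hE3 i (M i) c).symm)
      · simp only [List.mem_cons]
        rintro o (rfl | rfl | ho)
        · exact .inl rfl
        · exact .inr ⟨i, rfl⟩
        · exact h1 o ho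
      · intro j hj
        simp only [List.mem_cons]
        obtain h | h := (Fin.castSucc_le_castSucc_iff.1 hj).eq_or_lt
        · subst h; exact .inr (.inl rfl)
        · exact .inr (.inr (h2 j (Fin.succ_le_castSucc_iff.2 h)))
  obtain ⟨H, l, hp, hr, h1, h2⟩ := main 0 K hK fun c => (hrK.conv.appL c).symm
  refine hp.exists_proof (ReflTransGen.trans (start.apps Q) hrK) hr (fun o ho => ?_) fun s hs => ?_
  · obtain rfl | ⟨j, rfl⟩ := h1 o ho
    · exact (convOrd_le (leaf ⟨0, ht⟩)).trans (rank_endpiece_le leaf _)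
    · exact rank_endpiece_le leaf j
  · exact Ordinal.iSup_le fun j => hs _ (h2 j (Fin.zero_le _))

/-! ### Combinatory completeness -/

/-- The combinator `λ x y. x`. -/
def combK {k : ℕ} : Tm k := lam (lam (var 1))

/-- The combinator `λ x y z. x z (y z)`. -/
def combS {k : ℕ} : Tm k :=
  lam (lam (lam (app (app (var 2) (var 0)) (app (var 1) (var 0)))))

lemma combK_app {k : ℕ} (a : Tm k) : Conv (app combK a) (lam (a.rename Fin.succ)) :=
  (Beta.redex (lam (var 1)) a).conv

lemma combK_app_app {k : ℕ} (a b : Tm k) : Conv (app (app combK a) b) a := by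
  refine ((combK_app a).appL b).trans ?_
  have := (Beta.redex (a.rename Fin.succ) b).conv
  rwa [rename_succ_inst] at this

lemma combS_app_app {k : ℕ} (a b : Tm k) : Conv (app (app combS a) b)
    (lam (app (app (a.rename Fin.succ) (var 0)) (app (b.rename Fin.succ) (var 0)))) := by
  have h1 := (Beta.redex (lam (lam (app (app (var 2) (var 0)) (app (var 1) (var 0))))) a).conv
  refine (h1.appL b).trans ?_
  have h2 := (Beta.redex (lam (app (app ((a.rename Fin.succ).rename Fin.succ) (var 0))
    (app (var 1) (var 0)))) b).conv
  rw [inst_eq, subst_lam, subst_app, subst_app, rename_succ_subst_ups, rename_succ_subst_scons,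
    subst_id] at h2
  exact h2

lemma combS_lam_lam {k : ℕ} (a b : Tm (k + 1)) :
    Conv (app (app combS (lam a)) (lam b)) (lam (app a b)) := by
  refine (combS_app_app _ _).trans (Conv.lam (Conv.app ?_ ?_))
  · have := (Beta.redex (a.rename (upr Fin.succ)) (var 0)).conv
    rwa [rename_upr_succ_inst_var] at this
  · have := (Beta.redex (b.rename (upr Fin.succ)) (var 0)).conv
    rwa [rename_upr_succ_inst_var] at this

/-- The terms that are built from variables, `K` and `S` by application. -/
inductive Combinatory : {k : ℕ} → Tm k → Prop
  | var {k : ℕ} (i : Fin k) : Combinatory (var i)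
  | K {k : ℕ} : Combinatory (k := k) combK
  | S {k : ℕ} : Combinatory (k := k) combS
  | app {k : ℕ} {a b : Tm k} : Combinatory a → Combinatory b → Combinatory (app a b)

/-- Bracket abstraction: `λ x. x` is `S K K`, anything not containing `x` is handled by `K`, and
application by `S`. -/
theorem Combinatory.exists_lam {k : ℕ} :
    ∀ {a : Tm (k + 1)}, Combinatory a → ∃ b, Combinatory b ∧ Conv (lam a) b
  | _, .var i => by
    refine Fin.cases ?_ (fun i => ?_) i
    · refine ⟨_, (Combinatory.S.app .K).app .K, Conv.symm ?_⟩
      exact (combS_app_app _ _).trans (Conv.lam (combK_app_app _ _))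
    · exact ⟨_, Combinatory.K.app (.var i), (combK_app (Tm.var i)).symm⟩
  | _, .K => ⟨_, Combinatory.K.app .K, (combK_app combK).symm⟩
  | _, .S => ⟨_, Combinatory.K.app .S, (combK_app combS).symm⟩
  | _, .app ha hb => by
    obtain ⟨a, ha, h1⟩ := exists_lam ha
    obtain ⟨b, hb, h2⟩ := exists_lam hb
    exact ⟨_, (Combinatory.S.app ha).app hb,
      (combS_lam_lam _ _).symm.trans (((Conv.refl _).app h1).app h2)⟩

theorem exists_combinatory {k : ℕ} (t : Tm k) : ∃ b, Combinatory b ∧ Conv t b := by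
  induction t with
  | var i => exact ⟨_, .var i, .refl _⟩
  | app t u iht ihu =>
    obtain ⟨a, ha, h1⟩ := iht
    obtain ⟨b, hb, h2⟩ := ihu
    exact ⟨_, ha.app hb, h1.app h2⟩
  | lam t ih =>
    obtain ⟨a, ha, h1⟩ := ih
    obtain ⟨b, hb, h2⟩ := ha.exists_lam
    exact ⟨b, hb, h1.lam.trans h2⟩

/-! ### Closed terms up to conversion -/

/-- Convertibility of closed terms as a setoid. -/
def convSetoid : Setoid (Tm 0) := ⟨Conv, Conv.refl, Conv.symm, Conv.trans⟩

/-- Closed terms up to conversion. -/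
def ClosedMod : Type := Quotient convSetoid

/-- The class of a closed term up to conversion. -/
def mk (t : Tm 0) : ClosedMod := Quotient.mk convSetoid t

instance : Mul ClosedMod :=
  ⟨Quotient.map₂ app fun _ _ h _ _ h' => Conv.app h h'⟩

@[simp] lemma mk_app (a b : Tm 0) : mk (app a b) = mk a * mk b := rfl

lemma mk_eq_mk {a b : Tm 0} : mk a = mk b ↔ Conv a b :=
  ⟨fun h => Quotient.exact h, fun h => Quotient.sound (s := convSetoid) h⟩

lemma ClosedMod.exists_mk (a : ClosedMod) : ∃ t, mk t = a := Quotient.exists_rep a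

@[simp] lemma scons_one {k l : ℕ} (u : Tm l) (σ : Fin (k + 1) → Tm l) :
    scons u σ 1 = σ 0 := rfl

@[simp] lemma scons_two {k l : ℕ} (u : Tm l) (σ : Fin (k + 2) → Tm l) :
    scons u σ 2 = σ 1 := rfl

@[simp] lemma scons_three {k l : ℕ} (u : Tm l) (σ : Fin (k + 3) → Tm l) :
    scons u σ 3 = σ 2 := rfl

lemma mk_lam_subst_mul {k : ℕ} (b : Tm (k + 1)) (σ : Fin k → Tm 0) (a : Tm 0) :
    mk ((lam b).subst σ) * mk a = mk (b.subst (scons a σ)) := by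
  rw [← mk_app, mk_eq_mk, ← subst_ups_inst]
  exact (Beta.redex _ _).conv

lemma mk_lam_mul (b : Tm 1) (a : Tm 0) :
    mk (lam b) * mk a = mk (b.subst (scons a var)) := by
  rw [← mk_lam_subst_mul, subst_id]

lemma mk_lam₂_mul (b : Tm 2) (a c : Tm 0) :
    mk (lam (lam b)) * mk a * mk c = mk (b.subst (scons c (scons a var))) := by
  rw [mk_lam_mul, mk_lam_subst_mul]

lemma mk_lam₃_mul (b : Tm 3) (a c d : Tm 0) :
    mk (lam (lam (lam b))) * mk a * mk c * mk d =
      mk (b.subst (scons d (scons c (scons a var)))) := by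
  rw [mk_lam₂_mul, mk_lam_subst_mul]

lemma mk_lam₄_mul (b : Tm 4) (a c d e : Tm 0) :
    mk (lam (lam (lam (lam b)))) * mk a * mk c * mk d * mk e =
      mk (b.subst (scons e (scons d (scons c (scons a var))))) := by
  rw [mk_lam₃_mul, mk_lam_subst_mul]

/-- A closed term in the scope of further variables. -/
def lift {k : ℕ} (t : Tm 0) : Tm k := t.rename Fin.elim0

@[simp] lemma lift_subst {k : ℕ} (t : Tm 0) (σ : Fin k → Tm 0) : (lift t).subst σ = t := by
  rw [lift, rename_subst]
  convert subst_id t using 2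

@[simp] lemma lift_zero (t : Tm 0) : lift t = t := by
  simpa using lift_subst t var

/-- A fixed point of the closed term `h`. -/
def fixT (h : Tm 0) : Tm 0 :=
  app (lam (app (lift h) (app (var 0) (var 0)))) (lam (app (lift h) (app (var 0) (var 0))))

lemma mk_fixT (h : Tm 0) : mk (fixT h) = mk h * mk (fixT h) := by
  conv_lhs => rw [fixT, mk_app, mk_lam_mul]
  simp [fixT]

/-- `λ x y z. z x y`. -/
def pairT : Tm 0 := lam (lam (lam (app (app (var 0) (var 2)) (var 1))))

/-- The first projection. -/
def fstT : Tm 0 := lam (app (var 0) (lam (lam (var 1))))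

/-- The second projection. -/
def sndT : Tm 0 := lam (app (var 0) (lam (lam (var 0))))

@[simp] lemma fst_pair (a b : ClosedMod) : mk fstT * (mk pairT * a * b) = a := by
  obtain ⟨a, rfl⟩ := a.exists_mk
  obtain ⟨b, rfl⟩ := b.exists_mk
  rw [← mk_app, ← mk_app, fstT, mk_lam_mul]
  exact (mk_lam₃_mul _ a b (lam (lam (var 1)))).trans (mk_lam₂_mul _ a b)

@[simp] lemma snd_pair (a b : ClosedMod) : mk sndT * (mk pairT * a * b) = b := by
  obtain ⟨a, rfl⟩ := a.exists_mk
  obtain ⟨b, rfl⟩ := b.exists_mk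
  rw [← mk_app, ← mk_app, sndT, mk_lam_mul]
  exact (mk_lam₃_mul _ a b (lam (lam (var 0)))).trans (mk_lam₂_mul _ a b)

/-- The pair `⟨a, b⟩`. -/
def pr {k : ℕ} (a b : Tm k) : Tm k := app (app (lift pairT) a) b

/-- The first component of `a`. -/
def fs {k : ℕ} (a : Tm k) : Tm k := app (lift fstT) a

/-- The second component of `a`. -/
def sn {k : ℕ} (a : Tm k) : Tm k := app (lift sndT) a

/-! ### An enumeration of the closed terms -/

/-- The step `λ g P. ⟨K:s, S:s, (s₁ s₀):s₂, g (snd P)⟩` of the recursion that computes, from a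
stream `P` of stacks, the stream of the stacks that are obtained from those in `P` by pushing `K`,
by pushing `S`, and by applying the second entry `s₁` to the first entry `s₀`. -/
def expandStep : Tm 0 :=
  lam (lam (pr (pr (lift combK) (fs (var 0))) (pr (pr (lift combS) (fs (var 0)))
    (pr (pr (app (fs (sn (fs (var 0)))) (fs (fs (var 0)))) (sn (sn (fs (var 0)))))
      (app (var 1) (sn (var 0)))))))

/-- The stream of all successors of the stacks in a given stream. -/
def expandT : Tm 0 := fixT expandStep

/-- The stream of all stacks. -/
def stackStream : Tm 0 := fixT (lam (pr (lift combK) (app (lift expandT) (var 0))))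

lemma mk_expandT_mul (P : ClosedMod) : mk expandT * P =
    mk pairT * (mk pairT * mk combK * (mk fstT * P)) *
      (mk pairT * (mk pairT * mk combS * (mk fstT * P)) *
        (mk pairT * (mk pairT * (mk fstT * (mk sndT * (mk fstT * P)) * (mk fstT * (mk fstT * P)))
          * (mk sndT * (mk sndT * (mk fstT * P)))) * (mk expandT * (mk sndT * P)))) := by
  obtain ⟨P, rfl⟩ := P.exists_mk
  conv_lhs => rw [expandT, mk_fixT, expandStep, mk_lam₂_mul]
  simp [pr, fs, sn, expandT, expandStep]

lemma mk_stackStream : mk stackStream = mk pairT * mk combK * (mk expandT * mk stackStream) := by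
  conv_lhs => rw [stackStream, mk_fixT, mk_lam_mul]
  simp [pr, stackStream]

/-- The `n`-th tail of the stream of all stacks. -/
def tails : ℕ → Tm 0
  | 0 => stackStream
  | n + 1 => app sndT (tails n)

lemma mk_tails_succ (n : ℕ) : mk (tails (n + 1)) = mk sndT * mk (tails n) := rfl

/-- Each stack contributes three successors, so three tails of the expansion correspond to one tail
of its source; the offset `1` is the initial entry. -/
lemma mk_tails_three_mul (n : ℕ) : mk (tails (3 * n + 1)) = mk expandT * mk (tails n) := by
  induction n with
  | zero =>
    change mk sndT * mk stackStream = mk expandT * mk stackStream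
    conv_lhs => rw [mk_stackStream, snd_pair]
  | succ n ih =>
    rw [show 3 * (n + 1) + 1 = 3 * n + 1 + 1 + 1 + 1 by ring, mk_tails_succ, mk_tails_succ,
      mk_tails_succ, ih, mk_expandT_mul]
    simp [mk_tails_succ]

/-- The stack `s` is a member of the stream of all stacks. -/
def Reachable (s : ClosedMod) : Prop := ∃ n, mk fstT * mk (tails n) = s

lemma Reachable.pushK {s : ClosedMod} (h : Reachable s) :
    Reachable (mk pairT * mk combK * s) := by
  obtain ⟨n, rfl⟩ := h
  exact ⟨3 * n + 1, by rw [mk_tails_three_mul, mk_expandT_mul]; simp⟩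

lemma Reachable.pushS {s : ClosedMod} (h : Reachable s) :
    Reachable (mk pairT * mk combS * s) := by
  obtain ⟨n, rfl⟩ := h
  exact ⟨3 * n + 1 + 1, by rw [mk_tails_succ, mk_tails_three_mul, mk_expandT_mul]; simp⟩

lemma Reachable.apply {s : ClosedMod} (h : Reachable s) :
    Reachable (mk pairT * (mk fstT * (mk sndT * s) * (mk fstT * s)) *
      (mk sndT * (mk sndT * s))) := by
  obtain ⟨n, rfl⟩ := h
  exact ⟨3 * n + 1 + 1 + 1, by
    rw [mk_tails_succ, mk_tails_succ, mk_tails_three_mul, mk_expandT_mul]; simp⟩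

/-- Evaluation in postfix order: push `a`, push `b`, then apply. -/
theorem Reachable.push {s : ClosedMod} (h : Reachable s) :
    ∀ {t : Tm 0}, Combinatory t → Reachable (mk pairT * mk t * s)
  | _, .var i => i.elim0
  | _, .K => h.pushK
  | _, .S => h.pushS
  | _, .app ha hb => by
    have := ((h.push ha).push hb).apply
    simpa using this

lemma exists_mk_eq_tails (t : Tm 0) : ∃ n, mk t = mk fstT * (mk fstT * mk (tails n)) := by
  obtain ⟨b, hb, hc⟩ := exists_combinatory t
  -- The initial entry serves as the bottom of the stack; its contents are irrelevant.
  obtain ⟨n, hn⟩ := Reachable.push ⟨0, rfl⟩ hb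
  exact ⟨n, by rw [hn, mk_eq_mk.2 hc, fst_pair]⟩

/-! ### Plotkin's terms -/

/-- The head `e p` of the stream of closed terms `p`. -/
def hd {k : ℕ} (p : Tm k) : Tm k := fs (fs p)

/-- The step of the recursion `G F p = F (tl p) (e (tl p)) (G F (tl p)) (G F p)`. -/
def plotkinGStep : Tm 0 :=
  lam (lam (lam (app (app (app (app (var 1) (sn (var 0))) (hd (sn (var 0))))
    (app (app (var 2) (var 1)) (sn (var 0)))) (app (app (var 2) (var 1)) (var 0)))))

/-- The solution of `G F p = F (tl p) (e (tl p)) (G F (tl p)) (G F p)`. -/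
def plotkinG : Tm 0 := fixT plotkinGStep

/-- `F p (e p) (F (tl p) y (G F (tl p)) z)`, where `F` is `s s`. -/
def plotkinBody {k : ℕ} (s p y z : Tm k) : Tm k :=
  app (app (app (app s s) p) (hd p)) (app (app (app (app (app s s) (sn p)) y)
    (app (app (lift plotkinG) (app s s)) (sn p))) z)

/-- The abstraction of `plotkinBody`. -/
def plotkinHalf : Tm 0 := lam (lam (lam (lam (plotkinBody (var 3) (var 2) (var 1) (var 0)))))

/-- The solution of `F p y z = F p (e p) (F (tl p) y (G F (tl p)) z)`. -/
def plotkinF : Tm 0 := app plotkinHalf plotkinHalf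

lemma mk_plotkinG (F p : ClosedMod) : mk plotkinG * F * p =
    F * (mk sndT * p) * (mk fstT * (mk fstT * (mk sndT * p))) *
      (mk plotkinG * F * (mk sndT * p)) * (mk plotkinG * F * p) := by
  obtain ⟨F, rfl⟩ := F.exists_mk
  obtain ⟨p, rfl⟩ := p.exists_mk
  conv_lhs => rw [plotkinG, mk_fixT, plotkinGStep, mk_lam₃_mul]
  simp [hd, fs, sn, plotkinG, plotkinGStep]

lemma mk_plotkinF (p y z : ClosedMod) : mk plotkinF * p * y * z =
    mk plotkinF * p * (mk fstT * (mk fstT * p)) *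
      (mk plotkinF * (mk sndT * p) * y * (mk plotkinG * mk plotkinF * (mk sndT * p)) * z) := by
  obtain ⟨p, rfl⟩ := p.exists_mk
  obtain ⟨y, rfl⟩ := y.exists_mk
  obtain ⟨z, rfl⟩ := z.exists_mk
  conv_lhs => rw [plotkinF, mk_app, plotkinHalf, mk_lam₄_mul]
  simp [plotkinBody, hd, fs, sn, plotkinF, plotkinHalf]

/-- `F p₀ x (G F p₀)`, where `x` is a free variable and `p₀` enumerates all closed terms. -/
def plotkinT : Tm 1 :=
  app (app (app (lift plotkinF) (lift stackStream)) (var 0))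
    (lift (app (app plotkinG plotkinF) stackStream))

/-- A closed term to which all closed instances of `plotkinT` are convertible. -/
def plotkinW : Tm 0 :=
  app (app (app plotkinF stackStream) (hd stackStream))
    (app (app plotkinG plotkinF) stackStream)

/-- With `pₙ` the `n`-th tail and `eₙ = e pₙ`, unfolding `F` turns the left side into `F pₙ eₙ (F
pₙ₊₁ eₙ₊ₖ₊₁ (G F pₙ₊₁) (G F pₙ))`. By induction `eₙ₊ₖ₊₁` may be replaced by `eₙ₊₁`, and then the
equation of `G` folds the inner term to `G F pₙ`. -/
lemma plotkin_aux (k n : ℕ) :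
    mk plotkinF * mk (tails n) * (mk fstT * (mk fstT * mk (tails (n + k)))) *
        (mk plotkinG * mk plotkinF * mk (tails n)) =
      mk plotkinF * mk (tails n) * (mk fstT * (mk fstT * mk (tails n))) *
        (mk plotkinG * mk plotkinF * mk (tails n)) := by
  induction k generalizing n with
  | zero => rfl
  | succ k ih =>
    rw [mk_plotkinF (mk (tails n)) (mk fstT * (mk fstT * mk (tails (n + (k + 1))))),
      ← mk_tails_succ, show n + (k + 1) = n + 1 + k by ring, ih (n + 1), mk_tails_succ,
      ← mk_plotkinG]

theorem conv_inst_plotkinT (c : Tm 0) : Conv (plotkinT.inst c) plotkinW := by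
  rw [← mk_eq_mk]
  obtain ⟨n, hn⟩ := exists_mk_eq_tails c
  have := plotkin_aux n 0
  rw [zero_add, ← hn] at this
  refine Eq.trans ?_ (this.trans ?_)
  · simp [plotkinT, inst_eq, tails]
  · simp [plotkinW, tails, hd, fs]

/-! ### Variables that cannot be erased -/

/-- The variable `x` is free in the term. -/
def Occ : {k : ℕ} → Fin k → Tm k → Prop
  | _, x, var i => i = x
  | _, x, app t u => Occ x t ∨ Occ x u
  | _, x, lam t => Occ x.succ t

lemma occ_rename {k l : ℕ} (ρ : Fin k → Fin l) (t : Tm k) (y : Fin l) :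
    Occ y (t.rename ρ) ↔ ∃ x, ρ x = y ∧ Occ x t := by
  induction t generalizing l with
  | var i => simp [Occ]
  | app t u iht ihu =>
    simp only [rename_app, Occ, iht, ihu]
    constructor
    · rintro (⟨x, h, h'⟩ | ⟨x, h, h'⟩)
      exacts [⟨x, h, .inl h'⟩, ⟨x, h, .inr h'⟩]
    · rintro ⟨x, h, h' | h'⟩
      exacts [.inl ⟨x, h, h'⟩, .inr ⟨x, h, h'⟩]
  | lam t ih =>
    simp only [rename_lam, Occ, ih]
    constructor
    · rintro ⟨x, h⟩
      revert h
      refine Fin.cases (fun h => absurd h.1 (Fin.succ_ne_zero _).symm) (fun x h => ?_) x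
      exact ⟨x, Fin.succ_injective _ h.1, h.2⟩
    · rintro ⟨x, rfl, h⟩
      exact ⟨x.succ, rfl, h⟩

lemma Occ.of_peta {k : ℕ} {t t' : Tm k} (h : PEta t t') {x : Fin k} (hx : Occ x t) :
    Occ x t' := by
  induction h with
  | var i => exact hx
  | app _ _ iht ihu => exact hx.imp iht ihu
  | lam _ ih => exact ih hx
  | eta _ ih =>
    obtain hx | hx := hx
    · obtain ⟨y, h, hy⟩ := (occ_rename _ _ _).1 hx
      obtain rfl := Fin.succ_injective _ h
      exact ih hy
    · exact absurd hx (Fin.succ_ne_zero _).symm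

/-- The kinds of terms in the analysis of the reducts of `plotkinT`. -/
inductive Kind (k : ℕ) : Type
  /-- A term like `plotkinHalf`. -/
  | half
  /-- A term like `F`. -/
  | func
  /-- A term like `F p`: it retains all the arguments that it will be applied to. -/
  | retain
  /-- A term from which the variable `x` cannot be erased. -/
  | rel (x : Fin k)

/-- Extension of a set of variables under a binder. -/
def scope {k : ℕ} (p : Prop) (Γ : Fin k → Prop) : Fin (k + 1) → Prop := Fin.cases p Γ

/-- The term has the given kind if the variables in `Γ` have the kind `half`. -/
def HasKind : {k : ℕ} → (Fin k → Prop) → Kind k → Tm k → Prop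
  | _, Γ, .half, var i => Γ i
  | _, _, .func, var _ => False
  | _, _, .retain, var _ => False
  | _, _, .rel x, var i => i = x
  | _, _, .half, app _ _ => False
  | _, Γ, .func, app t u => HasKind Γ .half t ∧ HasKind Γ .half u
  | _, Γ, .retain, app t _ => HasKind Γ .func t ∨ HasKind Γ .retain t
  | _, Γ, .rel x, app t u => HasKind Γ (.rel x) t ∨ HasKind Γ .retain t ∧ HasKind Γ (.rel x) u
  | _, Γ, .half, lam t => HasKind (scope True Γ) .func t
  | _, Γ, .func, lam t => HasKind (scope False Γ) .retain t
  | _, Γ, .retain, lam t =>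
      HasKind (scope False Γ) .retain t ∧ HasKind (scope False Γ) (.rel 0) t
  | _, Γ, .rel x, lam t => HasKind (scope False Γ) (.rel x.succ) t

lemma HasKind.rename {k l : ℕ} (t : Tm k) (ρ : Fin k → Fin l) {Γ : Fin k → Prop}
    {Δ : Fin l → Prop} (h : ∀ i, Γ i → Δ (ρ i)) :
    (HasKind Γ .half t → HasKind Δ .half (t.rename ρ)) ∧
      (HasKind Γ .func t → HasKind Δ .func (t.rename ρ)) ∧
      (HasKind Γ .retain t → HasKind Δ .retain (t.rename ρ)) ∧
      ∀ x, HasKind Γ (.rel x) t → HasKind Δ (.rel (ρ x)) (t.rename ρ) := by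
  have hup : ∀ {k l : ℕ} {ρ : Fin k → Fin l} {Γ : Fin k → Prop} {Δ : Fin l → Prop},
      (∀ i, Γ i → Δ (ρ i)) → ∀ (p : Prop) (i : Fin (k + 1)),
      scope p Γ i → scope p Δ (upr ρ i) := fun h p i =>
    Fin.cases (fun hp => hp) (fun i hi => h i hi) i
  induction t generalizing l with
  | var i => exact ⟨h i, False.elim, False.elim, fun x hx => congrArg ρ hx⟩
  | app t u iht ihu =>
    obtain ⟨t1, t2, t3, t4⟩ := iht ρ h
    obtain ⟨u1, u2, u3, u4⟩ := ihu ρ h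
    exact ⟨False.elim, And.imp t1 u1, Or.imp t2 t3, fun x => Or.imp (t4 x) (And.imp t3 (u4 x))⟩
  | lam t ih =>
    obtain ⟨-, t2, -, -⟩ := ih (upr ρ) (hup h True)
    obtain ⟨-, -, t3, t4⟩ := ih (upr ρ) (hup h False)
    exact ⟨t2, t3, And.imp t3 (t4 0), fun x => t4 x.succ⟩

lemma HasKind.subst {k l : ℕ} (t : Tm k) (σ : Fin k → Tm l) {Γ : Fin k → Prop}
    {Δ : Fin l → Prop} (h : ∀ i, Γ i → HasKind Δ .half (σ i)) :
    (HasKind Γ .half t → HasKind Δ .half (t.subst σ)) ∧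
      (HasKind Γ .func t → HasKind Δ .func (t.subst σ)) ∧
      (HasKind Γ .retain t → HasKind Δ .retain (t.subst σ)) ∧
      ∀ x y, HasKind Δ (.rel y) (σ x) → HasKind Γ (.rel x) t →
        HasKind Δ (.rel y) (t.subst σ) := by
  have hup : ∀ {k l : ℕ} {σ : Fin k → Tm l} {Γ : Fin k → Prop} {Δ : Fin l → Prop},
      (∀ i, Γ i → HasKind Δ .half (σ i)) → ∀ (p : Prop) (i : Fin (k + 1)),
      scope p Γ i → HasKind (scope p Δ) .half (ups σ i) := fun h p i =>
    Fin.cases (fun hp => hp) (fun i hi => (HasKind.rename _ Fin.succ fun _ h => h).1 (h i hi)) i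
  induction t generalizing l with
  | var i => exact ⟨h i, False.elim, False.elim, fun x y hy hx => by
      obtain rfl : i = x := hx
      exact hy⟩
  | app t u iht ihu =>
    obtain ⟨t1, t2, t3, t4⟩ := iht σ h
    obtain ⟨u1, u2, u3, u4⟩ := ihu σ h
    exact ⟨False.elim, And.imp t1 u1, Or.imp t2 t3,
      fun x y hy => Or.imp (t4 x y hy) (And.imp t3 (u4 x y hy))⟩
  | lam t ih =>
    obtain ⟨-, t2, -, -⟩ := ih (ups σ) (hup h True)
    obtain ⟨-, -, t3, t4⟩ := ih (ups σ) (hup h False)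
    exact ⟨t2, t3, And.imp t3 (t4 0 0 rfl), fun x y hy => t4 x.succ y.succ
      ((HasKind.rename _ Fin.succ fun _ h => h).2.2.2 y hy)⟩

lemma HasKind.inst {k : ℕ} (b : Tm (k + 1)) (a : Tm k) {Γ : Fin k → Prop} {p : Prop}
    (h : p → HasKind Γ .half a) :
    (HasKind (scope p Γ) .func b → HasKind Γ .func (b.inst a)) ∧
      (HasKind (scope p Γ) .retain b → HasKind Γ .retain (b.inst a)) ∧
      (∀ x, HasKind (scope p Γ) (.rel (Fin.succ x)) b → HasKind Γ (.rel x) (b.inst a)) ∧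
      ∀ x, HasKind (scope p Γ) (.rel 0) b → HasKind Γ (.rel x) a →
        HasKind Γ (.rel x) (b.inst a) := by
  obtain ⟨-, h2, h3, h4⟩ := HasKind.subst b (scons a var) (Γ := scope p Γ) (Δ := Γ)
    fun i => Fin.cases h (fun i hi => hi) i
  exact ⟨h2, h3, fun x => h4 x.succ x rfl, fun x hb ha => h4 0 x ha hb⟩

/-- `β`-reduction preserves the kinds. -/
lemma HasKind.of_beta {k : ℕ} {t t' : Tm k} (h : Beta t t') {Γ : Fin k → Prop} :
    (HasKind Γ .half t → HasKind Γ .half t') ∧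
      (HasKind Γ .func t → HasKind Γ .func t') ∧
      (HasKind Γ .retain t → HasKind Γ .retain t') ∧
      ∀ x, HasKind Γ (.rel x) t → HasKind Γ (.rel x) t' := by
  induction h with
  | redex b a =>
    refine ⟨False.elim, fun h => (HasKind.inst b a fun _ => h.2).1 h.1, ?_, fun x => ?_⟩
    all_goals obtain ⟨-, h2, h3, h4⟩ := HasKind.inst b a (Γ := Γ) (p := False) False.elim
    · exact fun h => h.elim h2 fun h => h2 h.1
    -- A retaining abstraction has its bound variable in a position that cannot be erased, so an `x`
    -- in the argument survives the contraction.
    · exact fun h => h.elim (h3 x) fun h => h4 x h.1.2 h.2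
  | appL u _ ih =>
    obtain ⟨t1, t2, t3, t4⟩ := @ih Γ
    exact ⟨False.elim, And.imp_left t1, Or.imp t2 t3, fun x => Or.imp (t4 x) (And.imp_left t3)⟩
  | appR t _ ih =>
    obtain ⟨u1, u2, u3, u4⟩ := @ih Γ
    exact ⟨False.elim, And.imp_right u1, fun h => h,
      fun x => Or.imp_right (And.imp_right (u4 x))⟩
  | lam _ ih =>
    obtain ⟨-, t2, -, -⟩ := @ih (scope True Γ)
    obtain ⟨-, -, t3, t4⟩ := @ih (scope False Γ)
    exact ⟨t2, t3, And.imp t3 (t4 0), fun x => t4 x.succ⟩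

lemma HasKind.occ {k : ℕ} {t : Tm k} {Γ : Fin k → Prop} {x : Fin k}
    (h : HasKind Γ (.rel x) t) : Occ x t := by
  induction t with
  | var i => exact h
  | app t u iht ihu => exact h.elim (fun h => .inl (iht h)) fun h => .inr (ihu h.2)
  | lam t ih => exact ih h

/-- Both `y` and `z` recur as arguments of the retaining inner call `F (tl p)`, which is itself an
argument of the retaining `F p`. -/
lemma hasKind_plotkinHalf : HasKind Fin.elim0 .half plotkinHalf := by
  refine ⟨⟨.inr (.inr (.inl ⟨trivial, trivial⟩)), ?_⟩, ?_⟩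
  · exact .inr ⟨.inr (.inl ⟨trivial, trivial⟩), .inr ⟨.inr (.inr (.inl ⟨trivial, trivial⟩)), rfl⟩⟩
  · exact .inr ⟨.inr (.inl ⟨trivial, trivial⟩),
      .inl (.inl (.inr ⟨.inl ⟨trivial, trivial⟩, rfl⟩))⟩

lemma hasKind_plotkinT : HasKind (fun _ => False) (.rel 0) plotkinT := by
  have h := (HasKind.rename plotkinHalf Fin.elim0 (Δ := fun _ : Fin 1 => False)
    fun i => i.elim0).1 hasKind_plotkinHalf
  exact .inl (.inr ⟨.inl ⟨h, h⟩, rfl⟩)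

/-- After postponing `η`, the `β`-part preserves the kind `rel 0`, which implies that the variable
is free, and `η` never removes a free variable. -/
theorem plotkinT_ne_rename_of_red (t : Tm 1) (h : Red plotkinT t) (s : Tm 0) :
    t ≠ s.rename Fin.succ := by
  rintro rfl
  obtain ⟨w, h1, h2⟩ := h.exists_betaRed_etaRed
  have hw : HasKind (fun _ => False) (.rel 0) w := by
    clear h2
    induction h1 with
    | refl => exact hasKind_plotkinT
    | tail _ h ih => exact (HasKind.of_beta h).2.2.2 0 ih
  have hocc : ∀ {t u : Tm 1}, ReflTransGen PEta t u → Occ 0 t → Occ 0 u := fun h ht => by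
    induction h with
    | refl => exact ht
    | tail _ h ih => exact ih.of_peta h
  have := hocc h2 hw.occ
  obtain ⟨x, -⟩ := (occ_rename _ _ _).1 this
  exact x.elim0

end LamOmega

theorem mainTheorem5 (X : Set (LamOmega.Tm 0)) (hX : LamOmega.IsSupercofinal X)
    (M N : LamOmega.Tm 0) (T : LamOmega.OmegaProof M N) (hT : T.IsCanonical X)
    (hE : T.EndsInEndpiece) (P : List (LamOmega.Tm 0)) :
    ∃ (R : List (LamOmega.Tm 0)) (T₁ : LamOmega.OmegaProof ((M.apps P).apps R) ((N.apps P).apps R)),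
      T₁.IsCanonical X ∧ T₁.EndsInEndpiece ∧ T₁.rank = T.rank :=
  LamOmega.exists_canonical_apps hX LamOmega.plotkinT_ne_rename_of_red
    LamOmega.conv_inst_plotkinT T hT hE P
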